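/- Let $p_1,p_2\ge 1$ be integers, let $X=(X_1;X_2)$ be a zero-mean Gaussian random vector in $\mathbb R^{p_1}\times\mathbb R^{p_2}$ with covariance matrix $Q\succeq 0$ (possibly singular), written $X\in G(0,Q)$, and let $\Delta_1,\Delta_2\in[0,\infty)$. Let $\mathcal M(\Delta_1,\Delta_2)$ be the set of all joint laws of pairs $(X,\widehat X)$ with $\widehat X=(\widehat X_1;\widehat X_2)$ in $\mathbb R^{p_1}\times\mathbb R^{p_2}$ such that $X$ has law $G(0,Q)$ and $\mathbf E\|X_i-\widehat X_i\|^2\le\Delta_i$ for $i=1,2$. The joint rate distortion function is $$R(\Delta_1,\Delta_2)=\inf_{\mathcal M(\Delta_1,\Delta_2)} I(X_1,X_2;\widehat X_1,\widehat X_2)\in[0,\infty].$$ A Gaussian realization with matrices $(H,Q_V)$, $H,Q_V\in\mathbb R^{(p_1+p_2)\times(p_1+p_2)}$, $Q_V\succeq0$, is a pair $(X,\widehat X)$ with $X\in G(0,Q)$, $\widehat X=HX+V$, $V\in G(0,Q_V)$, and $V$ and $X$ independent. Then the following hold. (a) There is a zero-mean jointly Gaussian law of $(X,\widehat X)$ in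 $\mathcal M(\Delta_1,\Delta_2)$ that attains the infimum $R(\Delta_1,\Delta_2)$. (b) The infimum is attained by the law of some Gaussian realization $\widehat X=HX+V$. Moreover, every zero-mean jointly Gaussian law in $\mathcal M(\Delta_1,\Delta_2)$ (in particular every such minimizer) is the law of a Gaussian realization for some $(H,Q_V)$, and its test channel is $\mathbf P_{\widehat X|X=x}=G(Hx,Q_V)$ (the Gaussian law with mean $Hx$ and covariance $Q_V$) for almost every $x$. (c) Let $\mathcal M^{\mathrm{cm}}(\Delta_1,\Delta_2)$ be the set of laws in $\mathcal M(\Delta_1,\Delta_2)$ that satisfy the conditional-mean condition $\mathbf E\{X_i\mid\widehat X\}=\widehat X_i$ a.s., $i=1,2$, and let $\mathcal M^{\mathrm{cm},G}(\Delta_1,\Delta_2)$ be the set of laws of Gaussian realizations that satisfy the conditional-mean condition and $\mathbf E\|X_i-\widehat X_i\|^2\le\Delta_i$, $i=1,2$. Then $\mathcal M^{\mathrm{cm},G}(\Delta_1,\Delta_2)$ is a non-empty subset of $\mathcal M^{\mathrm{cm}}(\Delta_1,\Delta_2)$ and $$R(\Delta_1,\Delta_2)=\inf_{\mathcal M^{\mathrm{cm},G}(\Delta_1,\Delta_2)}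 I(X_1,X_2;\widehat X_1,\widehat X_2).$$ Moreover, a Gaussian realization for which $\mathrm{cov}(\widehat X,\widehat X)$ is invertible and $\mathrm{cov}(X,\widehat X)\,\mathrm{cov}(\widehat X,\widehat X)^{-1}=I_{p_1+p_2}$ satisfies the conditional-mean condition. -/

import Mathlib

open MeasureTheory ProbabilityTheory
open scoped ENNReal NNReal Matrix

namespace JointRDF

noncomputable section

/-- The space `ℝ^(p₁+p₂)` (Euclidean norm) of column vectors `x = (x₁; x₂)`. -/
abbrev Vec (p₁ p₂ : ℕ) : Type := EuclideanSpace ℝ (Fin p₁ ⊕ Fin p₂)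

/-- Real `(p₁+p₂) × (p₁+p₂)` matrices, in block form. -/
abbrev Mat (p₁ p₂ : ℕ) : Type := Matrix (Fin p₁ ⊕ Fin p₂) (Fin p₁ ⊕ Fin p₂) ℝ

/-- The first component `x₁ ∈ ℝ^p₁` of `x = (x₁; x₂)`. -/
def block₁ {p₁ p₂ : ℕ} (x : Vec p₁ p₂) : EuclideanSpace ℝ (Fin p₁) :=
  WithLp.toLp 2 fun i => x (Sum.inl i)

/-- The second component `x₂ ∈ ℝ^p₂` of `x = (x₁; x₂)`. -/
def block₂ {p₁ p₂ : ℕ} (x : Vec p₁ p₂) : EuclideanSpace ℝ (Fin p₂) :=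
  WithLp.toLp 2 fun i => x (Sum.inr i)

/-- The law `G(0, Q)` of the source `X = (X₁; X₂)`. -/
abbrev gaussianLaw {p₁ p₂ : ℕ} (Q : Mat p₁ p₂) : Measure (Vec p₁ p₂) :=
  multivariateGaussian 0 Q

/-- The mutual information `I(X; Y)` (in nats) of a pair `(X, Y)` with joint law `π`: the
Kullback-Leibler divergence of `π` from the product of its marginals. -/
def mutualInfo {α β : Type*} [MeasurableSpace α] [MeasurableSpace β]
    (π : Measure (α × β)) : ℝ≥0∞ :=
  InformationTheory.klDiv π (π.fst.prod π.snd)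

/-- `E ‖X₁ - X̂₁‖² ≤ Δ₁` and `E ‖X₂ - X̂₂‖² ≤ Δ₂`, where `π` is the law of `(X, X̂)`. -/
def MeetsDistortion {p₁ p₂ : ℕ} (Δ₁ Δ₂ : ℝ≥0) (π : Measure (Vec p₁ p₂ × Vec p₁ p₂)) : Prop :=
  ∫⁻ z, ‖block₁ z.1 - block₁ z.2‖ₑ ^ 2 ∂π ≤ Δ₁ ∧
    ∫⁻ z, ‖block₂ z.1 - block₂ z.2‖ₑ ^ 2 ∂π ≤ Δ₂

/-- The feasible set `M(Δ₁, Δ₂)`: all joint laws of `(X, X̂)` with `X`-marginal `G(0, Q)` that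
meet the two distortion constraints. -/
def feasible {p₁ p₂ : ℕ} (Q : Mat p₁ p₂) (Δ₁ Δ₂ : ℝ≥0) :
    Set (Measure (Vec p₁ p₂ × Vec p₁ p₂)) :=
  {π | IsProbabilityMeasure π ∧ π.fst = gaussianLaw Q ∧ MeetsDistortion Δ₁ Δ₂ π}

/-- The joint rate distortion function `R(Δ₁, Δ₂)`. -/
def rdf {p₁ p₂ : ℕ} (Q : Mat p₁ p₂) (Δ₁ Δ₂ : ℝ≥0) : ℝ≥0∞ :=
  ⨅ π ∈ feasible Q Δ₁ Δ₂, mutualInfo π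

/-- `π` is the law of a pair `(X, X̂)` with `X̂ = H X + V`, where `X ∈ G(0, Q)`, `V ∈ G(0, QV)`
with `QV ⪰ 0`, and `V` and `X` are independent. -/
def IsGaussianRealization {p₁ p₂ : ℕ} (Q H QV : Mat p₁ p₂)
    (π : Measure (Vec p₁ p₂ × Vec p₁ p₂)) : Prop :=
  QV.PosSemidef ∧
    ∃ (Ω : Type) (_ : MeasurableSpace Ω) (μ : Measure Ω) (_ : IsProbabilityMeasure μ)
      (X V Xhat : Ω → Vec p₁ p₂),
      HasLaw X (gaussianLaw Q) μ ∧ HasLaw V (gaussianLaw QV) μ ∧ IndepFun V X μ ∧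
        (∀ ω, Xhat ω = Matrix.toEuclideanLin H (X ω) + V ω) ∧
        HasLaw (fun ω => (X ω, Xhat ω)) π μ

/-- The conditional mean condition `E[Xᵢ | X̂] = X̂ᵢ` almost surely, `i = 1, 2`, where `π` is the
law of `(X, X̂)`. -/
def CondMeanEq {p₁ p₂ : ℕ} (π : Measure (Vec p₁ p₂ × Vec p₁ p₂)) : Prop :=
  (π[fun z => block₁ z.1 | MeasurableSpace.comap Prod.snd inferInstance]
      =ᵐ[π] fun z => block₁ z.2) ∧
    (π[fun z => block₂ z.1 | MeasurableSpace.comap Prod.snd inferInstance]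
      =ᵐ[π] fun z => block₂ z.2)

/-- The subset `M^cm(Δ₁, Δ₂)` of the feasible set. -/
def feasibleCM {p₁ p₂ : ℕ} (Q : Mat p₁ p₂) (Δ₁ Δ₂ : ℝ≥0) :
    Set (Measure (Vec p₁ p₂ × Vec p₁ p₂)) :=
  {π | π ∈ feasible Q Δ₁ Δ₂ ∧ CondMeanEq π}

/-- The set `M^{cm,G}(Δ₁, Δ₂)` of laws of Gaussian realizations `X̂ = H X + V` that satisfy the
conditional mean condition and the distortion constraints. -/
def feasibleCMG {p₁ p₂ : ℕ} (Q : Mat p₁ p₂) (Δ₁ Δ₂ : ℝ≥0) :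
    Set (Measure (Vec p₁ p₂ × Vec p₁ p₂)) :=
  {π | (∃ H QV : Mat p₁ p₂, IsGaussianRealization Q H QV π) ∧ CondMeanEq π ∧
    MeetsDistortion Δ₁ Δ₂ π}

/-- The matrix `cov(X, X̂)`, where `π` is the law of `(X, X̂)`. -/
def crossCov {p₁ p₂ : ℕ} (π : Measure (Vec p₁ p₂ × Vec p₁ p₂)) : Mat p₁ p₂ :=
  Matrix.of fun i j => cov[fun z => z.1 i, fun z => z.2 j; π]

/-- The matrix `cov(X̂, X̂)`, where `π` is the law of `(X, X̂)`. -/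
def reprCov {p₁ p₂ : ℕ} (π : Measure (Vec p₁ p₂ × Vec p₁ p₂)) : Mat p₁ p₂ :=
  Matrix.of fun i j => cov[fun z => z.2 i, fun z => z.2 j; π]

/-- Condition 1: `cov(X̂, X̂)` is invertible and `cov(X, X̂) cov(X̂, X̂)⁻¹ = I`. -/
def Condition1 {p₁ p₂ : ℕ} (π : Measure (Vec p₁ p₂ × Vec p₁ p₂)) : Prop :=
  IsUnit (reprCov π).det ∧ crossCov π * (reprCov π)⁻¹ = 1

end

end JointRDF

/-! The infimum reduces to maximising `∏ sⱼ` over the compact set of pairs `(A, s)` with `A Aᵀ = Q`,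
`sⱼ ∈ [0, 1]` and error covariance `A diag(s) Aᵀ` within the distortion budget; the value of a pair
is `-½ log ∏ sⱼ`. A full rank factorisation `Q = B Bᵀ`, `D B = I`, handles singular `Q`: `W = D X`
is standard Gaussian and `X = B W` almost surely.

Converse (`exists_parameter_of_feasible`). For any feasible law, Gaussian or not, project the `Wⱼ`
in `L²` onto the span of the coordinates of `X̂` and rotate by an orthogonal `O` until the residuals
are orthogonal. Their squared norms `sⱼ` and `A = B O` form an admissible pair, since projecting can
only shorten `Xᵢ - X̂ᵢ`. The Donsker–Varadhan inequality, tested on a Gaussian log density centred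
at the linear estimates, gives `I ≥ -½ log ∏ sⱼ`, and `I = ∞` if some `sⱼ = 0`.

Achievability (`exists_mem_feasibleCMG`). Given a pair, take independent Gaussian `Y`, `Z` with
covariances `I - diag(s)`, `diag(s)` and put `X = A (Y + Z)`, `X̂ = A Y`. The error `A Z` is
independent of `X̂`, so `E[X | X̂] = X̂`, and data processing bounds the information by the value of
the pair when `∏ sⱼ > 0`.

A maximising pair exists by compactness and yields the minimiser; if the maximum is `0`, every
feasible law has infinite information. The form `X̂ = H X + V` is linear regression, because
uncorrelated jointly Gaussian vectors are independent. -/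

namespace JointRDF

/-! ### Factorisation of the covariance and orthogonal residuals in a Hilbert space. -/

section LinearAlgebra

open scoped RealInnerProductSpace

variable {J n : Type*} [Fintype J] [DecidableEq J] [Fintype n]

/-- A positive semidefinite real matrix is diagonalised by an orthogonal matrix. -/
theorem exists_orthogonal_diagonalization {G : Matrix J J ℝ} (hG : G.PosSemidef) :
    ∃ (O : Matrix J J ℝ) (d : J → ℝ), Oᵀ * O = 1 ∧ O * Oᵀ = 1 ∧ (∀ j, 0 ≤ d j) ∧
      Oᵀ * G * O = Matrix.diagonal d := by
  have hH := hG.isHermitian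
  refine ⟨hH.eigenvectorUnitary, hH.eigenvalues, ?_, ?_, hG.eigenvalues_nonneg, ?_⟩
  · simpa [Matrix.star_eq_conjTranspose] using Unitary.coe_star_mul_self hH.eigenvectorUnitary
  · simpa [Matrix.star_eq_conjTranspose] using Unitary.coe_mul_star_self hH.eigenvectorUnitary
  · have := hH.conjStarAlgAut_star_eigenvectorUnitary
    simpa [Unitary.conjStarAlgAut_star_apply, Matrix.star_eq_conjTranspose, Function.comp_def]
      using this

/-- A full rank factorisation `Q = B Bᵀ` of a positive semidefinite matrix, with a left inverse
of `B`. -/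
theorem exists_fullRank_factorization [DecidableEq n] {Q : Matrix n n ℝ} (hQ : Q.PosSemidef) :
    ∃ (s : Finset n) (B : Matrix n s ℝ) (D : Matrix s n ℝ), B * Bᵀ = Q ∧ D * B = 1 := by
  obtain ⟨O, d, h1, h2, hd, hdiag⟩ := exists_orthogonal_diagonalization hQ
  have hQ' : Q = O * Matrix.diagonal d * Oᵀ := by
    rw [← hdiag]
    calc Q = (O * Oᵀ) * Q * (O * Oᵀ) := by rw [h2]; simp
      _ = _ := by simp only [Matrix.mul_assoc]
  -- Only nonzero eigenvalues are kept, so the columns of `O` can be scaled by `√dⱼ` for `B` and by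
  -- `1/√dⱼ` for its left inverse.
  let s : Finset n := {i | d i ≠ 0}
  have hs : ∀ j : s, d j ≠ 0 := fun j => (Finset.mem_filter.1 j.2).2
  refine ⟨s, Matrix.of fun i j => O i j * √(d j), Matrix.of fun j i => O i j / √(d j), ?_, ?_⟩
  · rw [hQ']
    ext i k
    rw [Matrix.mul_apply, Matrix.mul_apply]
    simp only [Matrix.of_apply, Matrix.transpose_apply, Matrix.mul_diagonal]
    have : ∀ j : s, O i j * √(d j) * (O k j * √(d j)) = O i j * d j * O k j := fun j => by
      linear_combination O i j * O k j * Real.mul_self_sqrt (hd j)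
    rw [Finset.sum_congr rfl fun j _ => this j,
      Finset.sum_coe_sort s (fun j => O i j * d j * O k j)]
    refine Finset.sum_subset (Finset.subset_univ _) fun j _ hj => ?_
    have : d j = 0 := by simpa [s] using hj
    simp [this]
  · ext j k
    have h := congrFun (congrFun h1 j) k
    simp only [Matrix.mul_apply, Matrix.transpose_apply] at h
    simp only [Matrix.mul_apply, Matrix.of_apply]
    have e : ∀ i, O i j / √(d j) * (O i k * √(d k)) = √(d k) / √(d j) * (O i j * O i k) :=
      fun i => by ring
    rw [Finset.sum_congr rfl fun i _ => e i, ← Finset.mul_sum, h, Matrix.one_apply,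
      Matrix.one_apply]
    by_cases hjk : j = k
    · subst hjk
      have : √(d j) ≠ 0 := (Real.sqrt_pos.2 ((hd j).lt_of_ne' (hs j))).ne'
      simp [this]
    · simp [hjk, Subtype.val_injective.ne hjk]

variable {H : Type*} [NormedAddCommGroup H] [InnerProductSpace ℝ H]

/-- The residual of the orthogonal projection of `x` onto the span of finitely many vectors. -/
theorem exists_orthogonal_residual (x : H) (y : n → H) :
    ∃ c : n → ℝ, ∀ k, ⟪x - ∑ l, c l • y l, y k⟫ = 0 := by
  let S := Submodule.span ℝ (Set.range y)
  have : FiniteDimensional ℝ S := FiniteDimensional.span_of_finite ℝ (Set.finite_range y)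
  obtain ⟨c, hc⟩ := (Submodule.mem_span_range_iff_exists_fun ℝ).1
    (S.starProjection_apply_mem x)
  refine ⟨c, fun k => ?_⟩
  rw [hc]
  exact Submodule.starProjection_inner_eq_zero x (y k) (Submodule.subset_span ⟨k, rfl⟩)

/-- After a rotation of an orthonormal family `w`, the residuals of its projection onto the span
of `y` are orthogonal; these residuals bound the distance from `∑ⱼ Bᵢⱼ wⱼ` to `yᵢ`. -/
theorem exists_rotated_residuals {w : J → H} (hw : Orthonormal ℝ w) (y : n → H)
    (B : Matrix n J ℝ) :
    ∃ (O : Matrix J J ℝ) (C : Matrix J n ℝ) (e : J → H), Oᵀ * O = 1 ∧ O * Oᵀ = 1 ∧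
      (∀ j, e j = ∑ k, O k j • w k - ∑ k, C j k • y k) ∧ (∀ j, ‖e j‖ ≤ 1) ∧
      ∀ i, ∑ j, (B * O) i j ^ 2 * ‖e j‖ ^ 2 ≤ ‖∑ j, B i j • w j - y i‖ ^ 2 := by
  let S := Submodule.span ℝ (Set.range y)
  have : FiniteDimensional ℝ S := FiniteDimensional.span_of_finite ℝ (Set.finite_range y)
  let P := Sᗮ.starProjection
  -- Diagonalising the Gram matrix of the residuals `P wⱼ` is what makes the rotated residuals
  -- orthogonal.
  obtain ⟨O, d, h1, h2, -, hdiag⟩ :=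
    exists_orthogonal_diagonalization (Matrix.posSemidef_gram ℝ fun j => P (w j))
  have hC : ∀ v : H, ∃ c : n → ℝ, ∑ k, c k • y k = v - P v := fun v => by
    refine (Submodule.mem_span_range_iff_exists_fun ℝ).1 ?_
    have : v - P v = S.starProjection v := by
      simp [P, Submodule.starProjection_orthogonal_val]
    rw [this]
    exact S.starProjection_apply_mem v
  choose c hc using hC
  refine ⟨O, Matrix.of fun j => c (∑ k, O k j • w k), fun j => P (∑ k, O k j • w k), h1, h2,
    fun j => by simp [hc], fun j => ?_, fun i => ?_⟩
  · refine (Submodule.norm_starProjection_apply_le _ _).trans (le_of_eq ?_)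
    have h := congrFun (congrFun h1 j) j
    simp only [Matrix.mul_apply, Matrix.transpose_apply, Matrix.one_apply_eq] at h
    have : ‖∑ k, O k j • w k‖ ^ 2 = 1 := by
      rw [← real_inner_self_eq_norm_sq, hw.inner_sum]
      simpa using h
    exact (pow_eq_one_iff_of_nonneg (norm_nonneg _) two_ne_zero).1 this
  -- `P` kills `yᵢ`, so the projected error is a combination of the orthogonal residuals; Pythagoras
  -- gives its norm, and `P` is a contraction.
  · have key : P (∑ j, B i j • w j - y i) = ∑ k, (B * O) i k • P (∑ j, O j k • w j) := by
      have hy : P (y i) = 0 := by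
        refine Submodule.starProjection_apply_eq_zero_iff _ |>.2 ?_
        exact Submodule.le_orthogonal_orthogonal _ (Submodule.subset_span ⟨i, rfl⟩)
      have hB : B * O * Oᵀ = B := by rw [Matrix.mul_assoc, h2, Matrix.mul_one]
      rw [map_sub, hy, sub_zero]
      simp only [map_sum, map_smul, Finset.smul_sum, smul_smul]
      rw [Finset.sum_comm]
      refine Finset.sum_congr rfl fun j _ => ?_
      rw [← Finset.sum_smul]
      congr 1
      conv_lhs => rw [← hB]
      simp [Matrix.mul_apply (M := B * O)]
    have orth : ∀ k l, ⟪P (∑ j, O j k • w j), P (∑ j, O j l • w j)⟫ =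
        if k = l then d k else 0 := fun k l => by
      have h := congrFun (congrFun hdiag k) l
      rw [Matrix.diagonal_apply] at h
      rw [← h]
      simp only [Matrix.mul_apply, Matrix.transpose_apply, Matrix.gram_apply, map_sum, map_smul,
        sum_inner, inner_sum, real_inner_smul_left, real_inner_smul_right, Finset.sum_mul]
      exact Finset.sum_congr rfl fun a _ => Finset.sum_congr rfl fun b _ => by ring
    calc ∑ j, (B * O) i j ^ 2 * ‖P (∑ k, O k j • w k)‖ ^ 2
        = ‖P (∑ j, B i j • w j - y i)‖ ^ 2 := by
          rw [key, ← real_inner_self_eq_norm_sq]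
          simp only [sum_inner, inner_sum, real_inner_smul_left, real_inner_smul_right, orth]
          refine Finset.sum_congr rfl fun j _ => ?_
          rw [← real_inner_self_eq_norm_sq, orth]
          simp
          ring
      _ ≤ _ := by
          gcongr
          exact Submodule.norm_starProjection_apply_le _ _

end LinearAlgebra

/-! ### Variational bound and exact formula for the divergence. -/

section Divergence

variable {α : Type*} [MeasurableSpace α]

/-- The Donsker–Varadhan lower bound, for a test function with `∫ exp g ∂ν = 1`. -/
theorem ofReal_integral_le_klDiv {μ ν : Measure α} [IsProbabilityMeasure μ]
    [IsProbabilityMeasure ν] {g : α → ℝ} (hg : Measurable g) (hgμ : Integrable g μ)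
    (hgν : ∫⁻ x, ENNReal.ofReal (Real.exp (g x)) ∂ν = 1) :
    ENNReal.ofReal (∫ x, g x ∂μ) ≤ InformationTheory.klDiv μ ν := by
  by_cases htop : InformationTheory.klDiv μ ν = ∞
  · simp [htop]
  obtain ⟨hac, hint⟩ := InformationTheory.klDiv_ne_top_iff.1 htop
  have hexp : Integrable (fun x => Real.exp (g x)) ν := by
    refine ⟨by fun_prop, ?_⟩
    rw [hasFiniteIntegral_iff_ofReal (ae_of_all _ fun x => (Real.exp_pos _).le), hgν]
    simp
  have hone : ∫ x, Real.exp (g x) ∂ν = 1 := by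
    rw [integral_eq_lintegral_of_nonneg_ae (ae_of_all _ fun x => (Real.exp_pos _).le)
      (by fun_prop), hgν]
    simp
  have : IsProbabilityMeasure (ν.tilted g) := isProbabilityMeasure_tilted hexp
  have h1 := integral_llr_tilted_right hac hgμ hexp hint
  have h2 := InformationTheory.integral_llr_add_sub_measure_univ_nonneg
    (hac.trans (absolutelyContinuous_tilted hexp))
    (integrable_llr_tilted_right hac hgμ hint hexp)
  rw [InformationTheory.klDiv_of_ac_of_integrable hac hint]
  rw [hone, Real.log_one] at h1
  simp only [probReal_univ] at h2 ⊢
  exact ENNReal.ofReal_le_ofReal (by linarith)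

/-- The divergence of a measure with density `exp g` is the integral of `g`. -/
theorem klDiv_withDensity_exp {ν : Measure α} [IsProbabilityMeasure ν] {g : α → ℝ}
    (hg : Measurable g)
    [IsProbabilityMeasure (ν.withDensity fun x => ENNReal.ofReal (Real.exp (g x)))]
    (hint : Integrable g (ν.withDensity fun x => ENNReal.ofReal (Real.exp (g x)))) :
    InformationTheory.klDiv (ν.withDensity fun x => ENNReal.ofReal (Real.exp (g x))) ν =
      ENNReal.ofReal (∫ x, g x ∂(ν.withDensity fun x => ENNReal.ofReal (Real.exp (g x)))) := by
  set μ := ν.withDensity fun x => ENNReal.ofReal (Real.exp (g x)) with hμ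
  have hac : μ ≪ ν := withDensity_absolutelyContinuous _ _
  have hllr : llr μ ν =ᵐ[μ] g := by
    refine hac.ae_le ?_
    filter_upwards [Measure.rnDeriv_withDensity ν
      (f := fun x => ENNReal.ofReal (Real.exp (g x))) (by fun_prop)] with x hx
    simp only [llr, hμ, hx]
    rw [ENNReal.toReal_ofReal (Real.exp_pos _).le, Real.log_exp]
  rw [InformationTheory.klDiv_of_ac_of_integrable hac ((integrable_congr hllr).2 hint),
    integral_congr_ae hllr]
  simp

end Divergence

/-! ### Gaussian densities relative to the standard Gaussian. -/

section Density

variable {J : Type*} [Fintype J]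

theorem lintegral_pi_prod_eq_prod_lintegral {μ : J → Measure ℝ}
    [∀ j, IsProbabilityMeasure (μ j)] {f : J → ℝ → ℝ≥0∞} (hf : ∀ j, Measurable (f j)) :
    ∫⁻ x, ∏ j, f j (x j) ∂(Measure.pi μ) = ∏ j, ∫⁻ t, f j t ∂(μ j) := by
  rw [lintegral_prod_eq_prod_lintegral_of_indepFun Finset.univ (fun j (x : J → ℝ) => f j (x j))
    (iIndepFun_pi fun j => (hf j).aemeasurable) (fun j => (hf j).comp (measurable_pi_apply j))]
  refine Finset.prod_congr rfl fun j _ => ?_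
  exact (measurePreserving_eval μ j).lintegral_comp (hf j)

theorem pi_withDensity {μ : J → Measure ℝ} [∀ j, IsProbabilityMeasure (μ j)]
    {f : J → ℝ → ℝ≥0∞} (hf : ∀ j, Measurable (f j))
    [∀ j, SigmaFinite ((μ j).withDensity (f j))] :
    Measure.pi (fun j => (μ j).withDensity (f j)) =
      (Measure.pi μ).withDensity fun x => ∏ j, f j (x j) := by
  refine Measure.pi_eq fun s hs => ?_
  rw [withDensity_apply _ (MeasurableSet.univ_pi hs),
    ← lintegral_indicator (MeasurableSet.univ_pi hs)]
  have : ∀ x : J → ℝ, (Set.univ.pi s).indicator (fun x => ∏ j, f j (x j)) x =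
      ∏ j, (s j).indicator (f j) (x j) := fun x => by
    by_cases hx : x ∈ Set.univ.pi s
    · rw [Set.indicator_of_mem hx]
      exact Finset.prod_congr rfl fun j _ => (Set.indicator_of_mem (hx j trivial) _).symm
    · rw [Set.indicator_of_notMem hx]
      simp only [Set.mem_pi, Set.mem_univ, true_implies, not_forall] at hx
      obtain ⟨j, hj⟩ := hx
      exact (Finset.prod_eq_zero (Finset.mem_univ j) (Set.indicator_of_notMem hj _)).symm
  rw [lintegral_congr this, lintegral_pi_prod_eq_prod_lintegral fun j => (hf j).indicator (hs j)]
  refine Finset.prod_congr rfl fun j _ => ?_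
  rw [lintegral_indicator (hs j), withDensity_apply _ (hs j)]

/-- The logarithm of the density of `N(m, s)` with respect to `N(0, 1)`. -/
noncomputable def gaussianLogDensity (s m w : ℝ) : ℝ :=
  -Real.log s / 2 - (w - m) ^ 2 / (2 * s) + w ^ 2 / 2

theorem gaussianReal_eq_withDensity {s : ℝ} (hs : 0 < s) (m : ℝ) :
    gaussianReal m s.toNNReal = (gaussianReal 0 1).withDensity
      fun w => ENNReal.ofReal (Real.exp (gaussianLogDensity s m w)) := by
  rw [gaussianReal_of_var_ne_zero _ (by simpa using hs), gaussianReal_of_var_ne_zero _ one_ne_zero,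
    ← withDensity_mul _ (measurable_gaussianPDF 0 1)
      (by unfold gaussianLogDensity; fun_prop)]
  congr 1
  ext w
  simp only [Pi.mul_apply, gaussianPDF, gaussianPDFReal]
  rw [← ENNReal.ofReal_mul (by positivity)]
  congr 1
  -- The ratio of normalising constants is absorbed into the exponent as `-log s / 2`.
  have h1 : √(2 * Real.pi * s) = √(2 * Real.pi) * Real.exp (Real.log s / 2) := by
    rw [Real.sqrt_mul (by positivity), Real.exp_half, Real.exp_log hs]
  rw [Real.coe_toNNReal _ hs.le, h1, mul_inv, ← Real.exp_neg, mul_assoc, ← Real.exp_add,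
    NNReal.coe_one, mul_one, mul_assoc, ← Real.exp_add]
  congr 2
  unfold gaussianLogDensity
  ring

variable [DecidableEq J]

/-- Characteristic functions are compared because some `sⱼ` may vanish, and then there is no
density. -/
theorem multivariateGaussian_diagonal {s : J → ℝ} (hs : ∀ j, 0 ≤ s j) (m : EuclideanSpace ℝ J) :
    multivariateGaussian m (Matrix.diagonal s) =
      (Measure.pi fun j => gaussianReal (m j) (s j).toNNReal).map (WithLp.toLp 2) := by
  apply Measure.ext_of_charFun (E := EuclideanSpace ℝ J)
  ext t
  rw [charFun_multivariateGaussian (Matrix.PosSemidef.diagonal hs), charFun_pi]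
  simp_rw [charFun_gaussianReal, ← Complex.exp_sum]
  congr 1
  simp only [PiLp.inner_apply, Finset.sum_sub_distrib, Matrix.mulVec_diagonal, dotProduct]
  simp only [RCLike.inner_apply, conj_trivial, Complex.ofReal_sum, Finset.sum_mul,
    Finset.sum_div]
  congr 1
  · exact Finset.sum_congr rfl fun j _ => by push_cast; ring
  · exact Finset.sum_congr rfl fun j _ => by
      rw [Real.coe_toNNReal _ (hs j)]; push_cast; ring

theorem multivariateGaussian_diagonal_eq_withDensity {s : J → ℝ} (hs : ∀ j, 0 < s j)
    (m : EuclideanSpace ℝ J) :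
    multivariateGaussian m (Matrix.diagonal s) =
      (stdGaussian (EuclideanSpace ℝ J)).withDensity
        fun w => ENNReal.ofReal (Real.exp (∑ j, gaussianLogDensity (s j) (m j) (w j))) := by
  have hmeas : ∀ j, Measurable fun w : ℝ =>
      ENNReal.ofReal (Real.exp (gaussianLogDensity (s j) (m j) w)) := fun j => by
    unfold gaussianLogDensity; fun_prop
  have hprob : ∀ j, IsProbabilityMeasure ((gaussianReal 0 1).withDensity
      fun w => ENNReal.ofReal (Real.exp (gaussianLogDensity (s j) (m j) w))) := fun j => by
    rw [← gaussianReal_eq_withDensity (hs j)]; infer_instance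
  rw [multivariateGaussian_diagonal fun j => (hs j).le]
  simp_rw [fun j => gaussianReal_eq_withDensity (hs j) (m j)]
  rw [pi_withDensity hmeas, ← map_pi_eq_stdGaussian]
  ext S hS
  rw [Measure.map_apply (by fun_prop) hS, withDensity_apply _ hS,
    withDensity_apply _ (by measurability), setLIntegral_map hS
      (by unfold gaussianLogDensity; fun_prop) (by fun_prop)]
  refine lintegral_congr fun x => ?_
  rw [← ENNReal.ofReal_prod_of_nonneg fun j _ => (Real.exp_pos _).le, Real.exp_sum]

/-- This is the normalisation that the Donsker–Varadhan bound needs, for each fixed value of the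
estimator. -/
theorem lintegral_exp_gaussianLogDensity {s : J → ℝ} (hs : ∀ j, 0 < s j)
    (m : EuclideanSpace ℝ J) :
    ∫⁻ w, ENNReal.ofReal (Real.exp (∑ j, gaussianLogDensity (s j) (m j) (w j)))
      ∂(stdGaussian (EuclideanSpace ℝ J)) = 1 := by
  rw [← setLIntegral_univ, ← withDensity_apply _ MeasurableSet.univ,
    ← multivariateGaussian_diagonal_eq_withDensity hs, measure_univ]

end Density

/-! ### First and second moments of Gaussian coordinates. -/

section Moments

variable {J : Type*} [Fintype J]

theorem memLp_eval_of_isGaussian (μ : Measure (EuclideanSpace ℝ J)) [IsGaussian μ] (j : J) :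
    MemLp (fun w => w j) 2 μ :=
  (EuclideanSpace.proj (𝕜 := ℝ) j).comp_memLp' IsGaussian.memLp_two_id

theorem integral_eval_of_isGaussian {μ : Measure (EuclideanSpace ℝ J)} [IsGaussian μ]
    (hμ : ∫ x, x ∂μ = 0) (j : J) : ∫ w, w j ∂μ = 0 := by
  have := (EuclideanSpace.proj (𝕜 := ℝ) j).integral_comp_id_comm
    (IsGaussian.integrable_id (μ := μ))
  simpa [hμ] using this

variable [DecidableEq J]

theorem integral_mul_multivariateGaussian {S : Matrix J J ℝ} (hS : S.PosSemidef) (i j : J) :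
    ∫ w, w i * w j ∂(multivariateGaussian 0 S) = S i j := by
  rw [← covariance_eval_multivariateGaussian (μ := 0) hS i j,
    covariance_eq_sub (memLp_eval_of_isGaussian _ i) (memLp_eval_of_isGaussian _ j),
    integral_eval_of_isGaussian (by simp), integral_eval_of_isGaussian (by simp)]
  simp

theorem integral_mul_stdGaussian (i j : J) :
    ∫ w, w i * w j ∂(stdGaussian (EuclideanSpace ℝ J)) = if i = j then 1 else 0 := by
  rw [← multivariateGaussian_zero_one, integral_mul_multivariateGaussian Matrix.PosSemidef.one,
    Matrix.one_apply]

end Moments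

/-! ### Lower bound on information and the diagonal channel attaining it. -/

section MutualInformation

variable {J : Type*} [Fintype J]

@[fun_prop]
theorem measurable_gaussianLogDensity {α : Type*} [MeasurableSpace α] (s : ℝ) {m w : α → ℝ}
    (hm : Measurable m) (hw : Measurable w) :
    Measurable fun a => gaussianLogDensity s (m a) (w a) := by
  unfold gaussianLogDensity
  fun_prop

theorem integrable_gaussianLogDensity {α : Type*} [MeasurableSpace α] {μ : Measure α}
    [IsProbabilityMeasure μ] (s : ℝ) {m w : α → ℝ}
    (h1 : Integrable (fun a => (w a - m a) ^ 2) μ) (h2 : Integrable (fun a => w a ^ 2) μ) :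
    Integrable (fun a => gaussianLogDensity s (m a) (w a)) μ := by
  unfold gaussianLogDensity
  exact ((integrable_const _).sub (h1.div_const _)).add (h2.div_const _)

theorem integral_gaussianLogDensity {α : Type*} [MeasurableSpace α] {μ : Measure α}
    [IsProbabilityMeasure μ] (s : ℝ) {m w : α → ℝ}
    (h1 : Integrable (fun a => (w a - m a) ^ 2) μ) (h2 : Integrable (fun a => w a ^ 2) μ) :
    ∫ a, gaussianLogDensity s (m a) (w a) ∂μ =
      -Real.log s / 2 - (∫ a, (w a - m a) ^ 2 ∂μ) / (2 * s) + (∫ a, w a ^ 2 ∂μ) / 2 := by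
  have h3 : Integrable (fun a => -Real.log s / 2 - (w a - m a) ^ 2 / (2 * s)) μ :=
    (integrable_const _).sub (h1.div_const _)
  unfold gaussianLogDensity
  rw [integral_add h3 (h2.div_const _), integral_sub (integrable_const _) (h1.div_const _),
    integral_div, integral_div, integral_div]
  simp

/-- Mutual information is at least the Gaussian value determined by the mean square errors of an
estimator `M` of a standard Gaussian function `W` of the source. -/
theorem ofReal_sum_log_le_mutualInfo {α β : Type*} [MeasurableSpace α] [MeasurableSpace β]
    {π : Measure (α × β)} [IsProbabilityMeasure π] {W : α → EuclideanSpace ℝ J}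
    (hW : Measurable W) (hstd : π.fst.map W = stdGaussian (EuclideanSpace ℝ J))
    {M : β → EuclideanSpace ℝ J} (hM : Measurable M)
    (hL2 : ∀ j, MemLp (fun z => W z.1 j - M z.2 j) 2 π) {s : J → ℝ} (hs : ∀ j, 0 < s j)
    (hle : ∀ j, ∫ z, (W z.1 j - M z.2 j) ^ 2 ∂π ≤ s j) :
    ENNReal.ofReal (∑ j, -Real.log (s j) / 2) ≤ mutualInfo π := by
  classical
  have hWπ : π.map (fun z => W z.1) = stdGaussian (EuclideanSpace ℝ J) := by
    rw [← hstd, Measure.fst, Measure.map_map hW measurable_fst]; rfl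
  have hW1 : Measurable fun z : α × β => W z.1 := by fun_prop
  have hM2 : Measurable fun z : α × β => M z.2 := by fun_prop
  have hWm : ∀ j, Measurable fun z : α × β => W z.1 j := fun j => by fun_prop
  have hMm : ∀ j, Measurable fun z : α × β => M z.2 j := fun j => by fun_prop
  have hWsq : ∀ j, Integrable (fun z => W z.1 j ^ 2) π := fun j => by
    have h := (memLp_eval_of_isGaussian (stdGaussian (EuclideanSpace ℝ J)) j).integrable_sq
    rw [← hWπ] at h
    exact h.comp_measurable hW1
  have hWint : ∀ j, ∫ z, W z.1 j ^ 2 ∂π = 1 := fun j => by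
    have h := integral_mul_stdGaussian j j
    rw [← hWπ, integral_map hW1.aemeasurable (by fun_prop)] at h
    simpa [sq] using h
  have hterm : ∀ j, Integrable
      (fun z => gaussianLogDensity (s j) (M z.2 j) (W z.1 j)) π := fun j => by
    exact integrable_gaussianLogDensity _ (hL2 j).integrable_sq (hWsq j)
  have hval : ∀ j, -Real.log (s j) / 2 ≤
      ∫ z, gaussianLogDensity (s j) (M z.2 j) (W z.1 j) ∂π := fun j => by
    rw [integral_gaussianLogDensity _ (hL2 j).integrable_sq (hWsq j), hWint]
    -- As `E Wⱼ² = 1` and the error is at most `sⱼ`, the two quadratic terms together contribute at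
    -- least `0`.
    have h : (∫ z, (W z.1 j - M z.2 j) ^ 2 ∂π) / (2 * s j) ≤ 1 / 2 := by
      rw [div_le_div_iff₀ (by linarith [hs j]) two_pos]
      linarith [hle j]
    linarith
  -- For fixed `y` the test function is the log density of `G(M y, diag s)` against the law of `W`,
  -- so its exponential has integral `1` under the product of the marginals.
  have hDV := ofReal_integral_le_klDiv (μ := π) (ν := π.fst.prod π.snd)
    (g := fun z => ∑ j, gaussianLogDensity (s j) (M z.2 j) (W z.1 j))
    (by fun_prop) (integrable_finsetSum _ fun j _ => hterm j) ?_
  · refine le_trans (ENNReal.ofReal_le_ofReal ?_) hDV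
    rw [integral_finsetSum _ fun j _ => hterm j]
    exact Finset.sum_le_sum fun j _ => hval j
  · rw [lintegral_prod_symm' _ (by fun_prop)]
    have : ∀ y, ∫⁻ x, ENNReal.ofReal
        (Real.exp (∑ j, gaussianLogDensity (s j) (M y j) (W x j))) ∂π.fst = 1 := fun y => by
      rw [← lintegral_exp_gaussianLogDensity hs (M y), ← hstd, lintegral_map (by fun_prop) hW]
    simp [this]

/-- The bound `I ≥ -½ log ∏ λⱼ`, including the degenerate case. -/
theorem mutualInfo_ge_of_errors {α β : Type*} [MeasurableSpace α] [MeasurableSpace β]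
    {π : Measure (α × β)} [IsProbabilityMeasure π] {W : α → EuclideanSpace ℝ J}
    (hW : Measurable W) (hstd : π.fst.map W = stdGaussian (EuclideanSpace ℝ J))
    {M : β → EuclideanSpace ℝ J} (hM : Measurable M)
    (hL2 : ∀ j, MemLp (fun z => W z.1 j - M z.2 j) 2 π) {s : J → ℝ}
    (hs : ∀ j, s j ∈ Set.Icc (0 : ℝ) 1) (heq : ∀ j, ∫ z, (W z.1 j - M z.2 j) ^ 2 ∂π = s j) :
    (0 < ∏ j, s j → ENNReal.ofReal (-Real.log (∏ j, s j) / 2) ≤ mutualInfo π) ∧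
      (∏ j, s j = 0 → mutualInfo π = ∞) := by
  classical
  constructor
  · intro hpos
    have hne : ∀ j, s j ≠ 0 := fun j => Finset.prod_ne_zero_iff.1 hpos.ne' j (Finset.mem_univ j)
    have := ofReal_sum_log_le_mutualInfo hW hstd hM hL2 (fun j => (hs j).1.lt_of_ne' (hne j))
      fun j => (heq j).le
    rwa [← Finset.sum_div, Finset.sum_neg_distrib, ← Real.log_prod fun j _ => hne j] at this
  · intro hzero
    obtain ⟨k, -, hk⟩ := Finset.prod_eq_zero_iff.1 hzero
    have key : ∀ r : ℝ, 0 ≤ r → ENNReal.ofReal r ≤ mutualInfo π := fun r hr => by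
      -- The true error in slot `k` is `0`, so `exp(-2r)` is an admissible bound there and
      -- contributes `r`; the bound `1` in the other slots contributes `0`. Here `r` is arbitrary.
      have h := ofReal_sum_log_le_mutualInfo hW hstd hM hL2
        (s := fun j => if j = k then Real.exp (-(2 * r)) else 1)
        (fun j => by split_ifs <;> positivity)
        (fun j => by
          rw [heq]
          split_ifs with hj
          · rw [hj, hk]; positivity
          · exact (hs j).2)
      refine le_trans (ENNReal.ofReal_le_ofReal (le_of_eq ?_)) h
      rw [Finset.sum_eq_single k (fun j _ hj => by simp [hj]) (by simp)]
      simp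
    refine ENNReal.eq_top_of_forall_nnreal_le fun r => ?_
    simpa using key r r.2

variable [DecidableEq J]

/-- The law of `(Y + Z, Y)`, with independent `Y ∈ G(0, I - diag s)` and `Z ∈ G(0, diag s)`. -/
noncomputable def diagonalTestLaw (s : J → ℝ) :
    Measure (EuclideanSpace ℝ J × EuclideanSpace ℝ J) :=
  ((multivariateGaussian 0 (Matrix.diagonal fun j => 1 - s j)).prod
    (multivariateGaussian 0 (Matrix.diagonal s))).map fun q => (q.1 + q.2, q.1)

instance (s : J → ℝ) : IsProbabilityMeasure (diagonalTestLaw s) :=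
  Measure.isProbabilityMeasure_map (by fun_prop)

theorem fst_diagonalTestLaw {s : J → ℝ} (hs : ∀ j, s j ∈ Set.Icc (0 : ℝ) 1) :
    (diagonalTestLaw s).fst = stdGaussian (EuclideanSpace ℝ J) := by
  rw [Measure.fst, diagonalTestLaw, Measure.map_map measurable_fst (by fun_prop)]
  apply Measure.ext_of_charFun
  have := charFun_map_add_prod_eq_mul
    (μ := multivariateGaussian 0 (Matrix.diagonal fun j => 1 - s j))
    (ν := multivariateGaussian 0 (Matrix.diagonal s))
  refine Eq.trans this ?_
  ext t
  rw [← multivariateGaussian_zero_one, Pi.mul_apply,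
    charFun_multivariateGaussian (Matrix.PosSemidef.diagonal fun j => sub_nonneg.2 (hs j).2),
    charFun_multivariateGaussian (Matrix.PosSemidef.diagonal fun j => (hs j).1),
    charFun_multivariateGaussian Matrix.PosSemidef.one, ← Complex.exp_add]
  congr 1
  have : (Matrix.diagonal fun j => 1 - s j) = 1 - Matrix.diagonal s := by
    rw [← Matrix.diagonal_one, Matrix.diagonal_sub]
  rw [this, Matrix.sub_mulVec, dotProduct_sub]
  push_cast
  simp
  ring

theorem snd_diagonalTestLaw (s : J → ℝ) : (diagonalTestLaw s).snd =
    multivariateGaussian 0 (Matrix.diagonal fun j => 1 - s j) := by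
  rw [Measure.snd, diagonalTestLaw, Measure.map_map measurable_snd (by fun_prop)]
  exact measurePreserving_fst.map_eq

theorem map_const_add_multivariateGaussian (m : EuclideanSpace ℝ J) (S : Matrix J J ℝ) :
    (multivariateGaussian 0 S).map (m + ·) = multivariateGaussian m S := by
  rw [multivariateGaussian, multivariateGaussian, Measure.map_map (by fun_prop) (by fun_prop)]
  congr 1
  ext x
  simp

/-- Given `Y = y`, the sum `Y + Z` has law `G(y, diag s)`, so the joint density is this conditional
density relative to the standard Gaussian. Positivity of `s` is essential. -/
theorem diagonalTestLaw_eq_withDensity {s : J → ℝ} (hs : ∀ j, s j ∈ Set.Ioc (0 : ℝ) 1) :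
    diagonalTestLaw s = ((diagonalTestLaw s).fst.prod (diagonalTestLaw s).snd).withDensity
      fun z => ENNReal.ofReal (Real.exp (∑ j, gaussianLogDensity (s j) (z.2 j) (z.1 j))) := by
  rw [snd_diagonalTestLaw, fst_diagonalTestLaw fun j => ⟨(hs j).1.le, (hs j).2⟩]
  refine Measure.ext_of_lintegral _ fun f hf => ?_
  have hd : Measurable fun z : EuclideanSpace ℝ J × EuclideanSpace ℝ J =>
      ENNReal.ofReal (Real.exp (∑ j, gaussianLogDensity (s j) (z.2 j) (z.1 j))) := by fun_prop
  rw [lintegral_withDensity_eq_lintegral_mul _ hd hf, lintegral_prod_symm' _ (hd.mul hf),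
    diagonalTestLaw, lintegral_map hf (by fun_prop), lintegral_prod _ (by fun_prop)]
  refine lintegral_congr fun y => ?_
  have h1 : Measurable fun w : EuclideanSpace ℝ J => f (w, y) := by fun_prop
  calc ∫⁻ z, f (y + z, y) ∂(multivariateGaussian 0 (Matrix.diagonal s))
      = ∫⁻ w, f (w, y) ∂(multivariateGaussian y (Matrix.diagonal s)) := by
        rw [← map_const_add_multivariateGaussian y, lintegral_map h1 (by fun_prop)]
    _ = _ := by
        rw [multivariateGaussian_diagonal_eq_withDensity fun j => (hs j).1,
          lintegral_withDensity_eq_lintegral_mul _ (by fun_prop) h1]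
        rfl

/-- The test function of the lower bound is here the exact log density and the errors equal `sⱼ`, so
the bound is attained. -/
theorem mutualInfo_diagonalTestLaw {s : J → ℝ} (hs : ∀ j, s j ∈ Set.Ioc (0 : ℝ) 1) :
    mutualInfo (diagonalTestLaw s) = ENNReal.ofReal (-Real.log (∏ j, s j) / 2) := by
  have hs' : ∀ j, s j ∈ Set.Icc (0 : ℝ) 1 := fun j => ⟨(hs j).1.le, (hs j).2⟩
  have hmap1 : Measurable fun q : EuclideanSpace ℝ J × EuclideanSpace ℝ J =>
      (q.1 + q.2, q.1) := by fun_prop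
  have hD := diagonalTestLaw_eq_withDensity hs
  have herr : (diagonalTestLaw s).map (fun z => z.1 - z.2) =
      multivariateGaussian 0 (Matrix.diagonal s) := by
    rw [diagonalTestLaw, Measure.map_map (by fun_prop) hmap1]
    have : ((fun z : EuclideanSpace ℝ J × EuclideanSpace ℝ J => z.1 - z.2) ∘
        fun q => (q.1 + q.2, q.1)) = Prod.snd := by ext q; simp
    rw [this]
    exact measurePreserving_snd.map_eq
  have hfst : (diagonalTestLaw s).map Prod.fst = stdGaussian (EuclideanSpace ℝ J) :=
    fst_diagonalTestLaw hs'
  have i1 : ∀ j, Integrable (fun z => (z.1 j - z.2 j) ^ 2) (diagonalTestLaw s) := fun j => by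
    have h := (memLp_eval_of_isGaussian (multivariateGaussian 0 (Matrix.diagonal s)) j).integrable_sq
    rw [← herr] at h
    exact h.comp_measurable (by fun_prop)
  have i2 : ∀ j, Integrable (fun z => z.1 j ^ 2) (diagonalTestLaw s) := fun j => by
    have h := (memLp_eval_of_isGaussian (stdGaussian (EuclideanSpace ℝ J)) j).integrable_sq
    rw [← hfst] at h
    exact h.comp_measurable (by fun_prop)
  have e1 : ∀ j, ∫ z, (z.1 j - z.2 j) ^ 2 ∂(diagonalTestLaw s) = s j := fun j => by
    have h := integral_mul_multivariateGaussian
      (Matrix.PosSemidef.diagonal fun j => (hs' j).1) j j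
    rw [← herr, integral_map (by fun_prop) (by fun_prop)] at h
    simpa [sq] using h
  have e2 : ∀ j, ∫ z, z.1 j ^ 2 ∂(diagonalTestLaw s) = 1 := fun j => by
    have h := integral_mul_stdGaussian j j
    rw [← hfst, integral_map (by fun_prop) (by fun_prop)] at h
    simpa [sq] using h
  have hterm : ∀ j, Integrable
      (fun z => gaussianLogDensity (s j) (z.2 j) (z.1 j)) (diagonalTestLaw s) := fun j => by
    exact integrable_gaussianLogDensity _ (i1 j) (i2 j)
  have hval : ∀ j, ∫ z, gaussianLogDensity (s j) (z.2 j) (z.1 j) ∂(diagonalTestLaw s) =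
      -Real.log (s j) / 2 := fun j => by
    rw [integral_gaussianLogDensity _ (i1 j) (i2 j), e1, e2]
    have := (hs j).1.ne'
    field_simp
    ring
  have hprob : IsProbabilityMeasure (((diagonalTestLaw s).fst.prod
      (diagonalTestLaw s).snd).withDensity fun z =>
        ENNReal.ofReal (Real.exp (∑ j, gaussianLogDensity (s j) (z.2 j) (z.1 j)))) := by
    rw [← hD]; infer_instance
  have hint := integrable_finsetSum Finset.univ fun j _ => hterm j
  have hKL := klDiv_withDensity_exp (ν := (diagonalTestLaw s).fst.prod (diagonalTestLaw s).snd)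
    (g := fun z => ∑ j, gaussianLogDensity (s j) (z.2 j) (z.1 j)) (by fun_prop)
    (by rw [← hD]; exact hint)
  rw [← hD] at hKL
  rw [mutualInfo, hKL, integral_finsetSum _ fun j _ => hterm j,
    Finset.sum_congr rfl fun j _ => hval j, ← Finset.sum_div, Finset.sum_neg_distrib,
    ← Real.log_prod fun j _ => (hs j).1.ne']

/-- Data processing: mutual information does not increase under separate maps of the pair. -/
theorem mutualInfo_map_le {α β γ δ : Type*} [MeasurableSpace α] [MeasurableSpace β]
    [MeasurableSpace γ] [MeasurableSpace δ] (π : Measure (α × β)) [IsProbabilityMeasure π]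
    {f : α → γ} {g : β → δ} (hf : Measurable f) (hg : Measurable g) :
    mutualInfo (π.map (Prod.map f g)) ≤ mutualInfo π := by
  have h1 : (π.map (Prod.map f g)).fst = π.fst.map f := by
    rw [Measure.fst, Measure.fst, Measure.map_map measurable_fst (by fun_prop),
      Measure.map_map hf measurable_fst]
    rfl
  have h2 : (π.map (Prod.map f g)).snd = π.snd.map g := by
    rw [Measure.snd, Measure.snd, Measure.map_map measurable_snd (by fun_prop),
      Measure.map_map hg measurable_snd]
    rfl
  rw [mutualInfo, h1, h2, Measure.map_prod_map _ _ hf hg]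
  exact InformationTheory.klDiv_map_le _ _ (hf.prodMap hg)

end MutualInformation

/-! ### Random variables as vectors of `L²`. -/

section SquareIntegrable

variable {Ω : Type*} [MeasurableSpace Ω] {μ : Measure Ω} {n : Type*} [Fintype n]

theorem inner_toLp_toLp {f g : Ω → ℝ} (hf : MemLp f 2 μ) (hg : MemLp g 2 μ) :
    inner ℝ (hf.toLp f) (hg.toLp g) = ∫ ω, f ω * g ω ∂μ := by
  rw [L2.inner_def]
  refine integral_congr_ae ?_
  filter_upwards [hf.coeFn_toLp, hg.coeFn_toLp] with ω h1 h2
  simp [h1, h2, mul_comm]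

theorem norm_toLp_sq {f : Ω → ℝ} (hf : MemLp f 2 μ) :
    ‖hf.toLp f‖ ^ 2 = ∫ ω, f ω ^ 2 ∂μ := by
  rw [← real_inner_self_eq_norm_sq, inner_toLp_toLp]
  simp [sq]

theorem memLp_linearCombination {Y : n → Ω → ℝ} (hY : ∀ k, MemLp (Y k) 2 μ) (c : n → ℝ) :
    MemLp (fun ω => ∑ k, c k * Y k ω) 2 μ :=
  memLp_finsetSum _ fun k _ => (hY k).const_mul (c k)

/-- Links pointwise linear combinations to vectors of `L²`, where the projection arguments take
place. -/
theorem toLp_linearCombination {Y : n → Ω → ℝ} (hY : ∀ k, MemLp (Y k) 2 μ) (c : n → ℝ) :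
    (memLp_linearCombination hY c).toLp (fun ω => ∑ k, c k * Y k ω) =
      ∑ k, c k • (hY k).toLp (Y k) := by
  refine Lp.ext ?_
  have h1 : ∀ᵐ ω ∂μ, ∀ k, (c k • (hY k).toLp (Y k) : Lp ℝ 2 μ) ω = c k * Y k ω :=
    ae_all_iff.2 fun k => by
      filter_upwards [Lp.coeFn_smul (c k) ((hY k).toLp (Y k)), (hY k).coeFn_toLp] with ω h h'
      rw [h, Pi.smul_apply, h', smul_eq_mul]
  filter_upwards [(memLp_linearCombination hY c).coeFn_toLp,
    Lp.coeFn_finsetSum Finset.univ (fun k => c k • (hY k).toLp (Y k)), h1] with ω h2 h3 h4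
  rw [h2, h3, Finset.sum_apply]
  exact Finset.sum_congr rfl fun k _ => (h4 k).symm

/-- The best linear estimator of `X` given `Y₁, …, Yₙ`: its error is orthogonal to every `Yₖ`. -/
theorem exists_linear_estimator {X : Ω → ℝ} (hX : MemLp X 2 μ) {Y : n → Ω → ℝ}
    (hY : ∀ k, MemLp (Y k) 2 μ) :
    ∃ c : n → ℝ, ∀ k, ∫ ω, (X ω - ∑ l, c l * Y l ω) * Y k ω ∂μ = 0 := by
  obtain ⟨c, hc⟩ := exists_orthogonal_residual (hX.toLp X) fun k => (hY k).toLp (Y k)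
  refine ⟨c, fun k => ?_⟩
  rw [← hc k, ← toLp_linearCombination hY, ← MemLp.toLp_sub hX (memLp_linearCombination hY c),
    inner_toLp_toLp]
  rfl

end SquareIntegrable

/-! ### Linear regression and disintegration of Gaussian pairs. -/

section Regression

variable {n : Type*} [Fintype n]

theorem memLp_fst_eval (π : Measure (EuclideanSpace ℝ n × EuclideanSpace ℝ n)) [IsGaussian π]
    (i : n) : MemLp (fun z => z.1 i) 2 π :=
  ((EuclideanSpace.proj (𝕜 := ℝ) i).comp (ContinuousLinearMap.fst ℝ (EuclideanSpace ℝ n)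
    (EuclideanSpace ℝ n))).comp_memLp' (IsGaussian.memLp_two_id (μ := π))

theorem memLp_snd_eval (π : Measure (EuclideanSpace ℝ n × EuclideanSpace ℝ n)) [IsGaussian π]
    (i : n) : MemLp (fun z => z.2 i) 2 π :=
  ((EuclideanSpace.proj (𝕜 := ℝ) i).comp (ContinuousLinearMap.snd ℝ (EuclideanSpace ℝ n)
    (EuclideanSpace ℝ n))).comp_memLp' (IsGaussian.memLp_two_id (μ := π))

theorem integral_clm_eq_zero {E F : Type*} [NormedAddCommGroup E] [NormedSpace ℝ E]
    [MeasurableSpace E] [BorelSpace E] [CompleteSpace E] [SecondCountableTopology E]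
    [NormedAddCommGroup F] [NormedSpace ℝ F] [CompleteSpace F] {π : Measure E} [IsGaussian π]
    (hπ : ∫ z, z ∂π = 0) (L : E →L[ℝ] F) : ∫ z, L z ∂π = 0 := by
  rw [L.integral_comp_comm IsGaussian.integrable_fun_id, hπ, map_zero]

/-- Linear images of a jointly Gaussian pair that are uncorrelated are independent. -/
theorem indepFun_of_orthogonal {π : Measure (EuclideanSpace ℝ n × EuclideanSpace ℝ n)}
    [IsGaussian π] (hπ : ∫ z, z ∂π = 0)
    (L M : EuclideanSpace ℝ n × EuclideanSpace ℝ n →L[ℝ] EuclideanSpace ℝ n)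
    (h : ∀ i j, ∫ z, L z i * M z j ∂π = 0) : IndepFun (fun z => L z) (fun z => M z) π := by
  have hG : HasGaussianLaw (fun z => (fun i => L z i, fun j => M z j)) π :=
    IsGaussian.hasGaussianLaw_id.map_fun
      (((PiLp.continuousLinearEquiv 2 ℝ (fun _ : n => ℝ)).toContinuousLinearMap.comp L).prod
        ((PiLp.continuousLinearEquiv 2 ℝ (fun _ : n => ℝ)).toContinuousLinearMap.comp M))
  have hcov : ∀ i j, cov[fun z => L z i, fun z => M z j; π] = 0 := fun i j => by
    rw [covariance_eq_sub (hG.fst.eval i).memLp_two (hG.snd.eval j).memLp_two]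
    have h1 : ∫ z, L z i ∂π = 0 :=
      integral_clm_eq_zero hπ ((EuclideanSpace.proj (𝕜 := ℝ) i).comp L)
    rw [h1]
    simpa using h i j
  exact (hG.indepFun_of_covariance_eval hcov).comp
    (WithLp.measurable_toLp 2 (n → ℝ)) (WithLp.measurable_toLp 2 (n → ℝ))

variable [DecidableEq n]

/-- A zero mean Gaussian measure on `ℝⁿ` is `G(0, S)` for some `S ⪰ 0`. -/
theorem exists_eq_multivariateGaussian (μ : Measure (EuclideanSpace ℝ n)) [IsGaussian μ]
    (hμ : ∫ x, x ∂μ = 0) :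
    ∃ S : Matrix n n ℝ, S.PosSemidef ∧ μ = multivariateGaussian 0 S := by
  -- `S` is the matrix of the covariance form; mean and covariance determine a Gaussian measure.
  let b := (EuclideanSpace.basisFun n ℝ).toBasis
  let S := LinearMap.BilinForm.toMatrix b (covarianceBilin μ).toBilinForm
  have hS : ∀ x y : EuclideanSpace ℝ n, x ⬝ᵥ S *ᵥ y = covarianceBilin μ x y := fun x y => by
    have := LinearMap.BilinForm.dotProduct_toMatrix_mulVec b (covarianceBilin μ).toBilinForm x y
    have h2 : ∀ x : EuclideanSpace ℝ n, b.equivFun.symm x.ofLp = x := fun x => by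
      have : (EuclideanSpace.basisFun n ℝ).repr.symm x = x :=
        ((EuclideanSpace.basisFun n ℝ).repr.symm_apply_eq).2 (by ext; simp)
      simp [b, this]
    rw [this, h2, h2]
    rfl
  have hpsd : S.PosSemidef := by
    refine Matrix.PosSemidef.of_dotProduct_mulVec_nonneg ?_ fun x => ?_
    · ext i j
      simp [S, LinearMap.BilinForm.toMatrix_apply, covarianceBilin_comm]
    · have := hS (WithLp.toLp 2 x) (WithLp.toLp 2 x)
      simp only [star_trivial]
      rw [this]
      exact covarianceBilin_self_nonneg _
  refine ⟨S, hpsd, IsGaussian.ext ?_ ?_⟩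
  · simpa using hμ
  · ext x y
    rw [covarianceBilin_multivariateGaussian hpsd, hS]

/-- Linear regression `X̂ = H X + V` of a zero mean jointly Gaussian pair. -/
theorem exists_gaussian_regression {π : Measure (EuclideanSpace ℝ n × EuclideanSpace ℝ n)}
    [IsGaussian π] (hπ : ∫ z, z ∂π = 0) :
    ∃ H S : Matrix n n ℝ, S.PosSemidef ∧
      IndepFun (fun z => z.2 - Matrix.toEuclideanLin H z.1) Prod.fst π ∧
      HasLaw (fun z => z.2 - Matrix.toEuclideanLin H z.1) (multivariateGaussian 0 S) π := by
  have hH := fun i => exists_linear_estimator (memLp_snd_eval π i) (memLp_fst_eval π)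
  choose H hH using hH
  let L : EuclideanSpace ℝ n × EuclideanSpace ℝ n →L[ℝ] EuclideanSpace ℝ n :=
    ContinuousLinearMap.snd ℝ _ _ -
      (Matrix.toEuclideanLin (Matrix.of H)).toContinuousLinearMap.comp
        (ContinuousLinearMap.fst ℝ _ _)
  have hL : ∀ z, L z = z.2 - Matrix.toEuclideanLin (Matrix.of H) z.1 := fun z => rfl
  obtain ⟨S, hS, hSeq⟩ := exists_eq_multivariateGaussian (π.map L) (by
    rw [integral_map (by fun_prop) (by fun_prop)]
    exact integral_clm_eq_zero hπ L)
  refine ⟨Matrix.of H, S, hS, ?_, ⟨L.continuous.aemeasurable, hSeq⟩⟩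
  refine indepFun_of_orthogonal hπ L (ContinuousLinearMap.fst ℝ _ _) fun i j => ?_
  rw [← hH i j]
  refine integral_congr_ae (ae_of_all _ fun z => ?_)
  simp [hL, Matrix.toLpLin_apply, Matrix.mulVec, dotProduct]

/-- The disintegration of the law of `(X, H X + V)`, with `V ∈ G(0, S)` independent of `X`. -/
theorem condKernel_ae_eq_multivariateGaussian
    {π : Measure (EuclideanSpace ℝ n × EuclideanSpace ℝ n)} [IsProbabilityMeasure π]
    {H S : Matrix n n ℝ} (hind : IndepFun (fun z => z.2 - Matrix.toEuclideanLin H z.1) Prod.fst π)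
    (hlaw : HasLaw (fun z => z.2 - Matrix.toEuclideanLin H z.1) (multivariateGaussian 0 S) π) :
    ∀ᵐ x ∂π.fst, π.condKernel x = multivariateGaussian (Matrix.toEuclideanLin H x) S := by
  have hHc : Measurable (Matrix.toEuclideanLin H) :=
    (Matrix.toEuclideanLin H).toContinuousLinearMap.continuous.measurable
  have hT : Measurable fun p : EuclideanSpace ℝ n × EuclideanSpace ℝ n =>
    Matrix.toEuclideanLin H p.1 + p.2 := by fun_prop
  let κ : Kernel (EuclideanSpace ℝ n) (EuclideanSpace ℝ n) :=
    (Kernel.id ×ₖ Kernel.const _ (multivariateGaussian 0 S)).map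
      fun p : EuclideanSpace ℝ n × EuclideanSpace ℝ n => Matrix.toEuclideanLin H p.1 + p.2
  have hκ : ∀ x, κ x = multivariateGaussian (Matrix.toEuclideanLin H x) S := fun x => by
    rw [Kernel.map_apply _ hT, Kernel.prod_apply, Kernel.id_apply, Kernel.const_apply,
      Measure.dirac_prod, Measure.map_map hT (by fun_prop),
      ← map_const_add_multivariateGaussian (Matrix.toEuclideanLin H x)]
    rfl
  have : IsMarkovKernel κ := Kernel.IsMarkovKernel.map _ hT
  have hpair : π.map (fun z => (z.2 - Matrix.toEuclideanLin H z.1, z.1)) =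
      (multivariateGaussian 0 S).prod π.fst := by
    rw [(indepFun_iff_map_prod_eq_prod_map_map (by fun_prop) (by fun_prop)).1 hind, hlaw.map_eq]
    rfl
  -- The residual and `X` have a product law, so `κ` disintegrates `π`; conditional kernels are
  -- unique almost everywhere.
  have hdis : π = π.fst ⊗ₘ κ := by
    refine Measure.ext_of_lintegral _ fun f hf => ?_
    rw [Measure.lintegral_compProd hf]
    have h1 : ∫⁻ z, f z ∂π = ∫⁻ p, f (p.2, Matrix.toEuclideanLin H p.2 + p.1)
        ∂(π.map (fun z => (z.2 - Matrix.toEuclideanLin H z.1, z.1))) := by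
      rw [lintegral_map (by fun_prop) (by fun_prop)]
      simp
    rw [h1, hpair, lintegral_prod_symm' _ (by fun_prop)]
    refine lintegral_congr fun x => ?_
    rw [hκ, ← map_const_add_multivariateGaussian (Matrix.toEuclideanLin H x),
      lintegral_map (by fun_prop) (by fun_prop)]
  filter_upwards [eq_condKernel_of_measure_eq_compProd κ hdis] with x hx
  rw [← hx, hκ]

end Regression

/-! ### The conditional mean condition for Gaussian pairs. -/

section ConditionalMean

variable {p₁ p₂ : ℕ}

/-- `block₁` as a continuous linear map. -/
noncomputable def block₁CLM : Vec p₁ p₂ →L[ℝ] EuclideanSpace ℝ (Fin p₁) :=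
  LinearMap.toContinuousLinearMap
    { toFun := block₁, map_add' := fun _ _ => rfl, map_smul' := fun _ _ => rfl }

/-- `block₂` as a continuous linear map. -/
noncomputable def block₂CLM : Vec p₁ p₂ →L[ℝ] EuclideanSpace ℝ (Fin p₂) :=
  LinearMap.toContinuousLinearMap
    { toFun := block₂, map_add' := fun _ _ => rfl, map_smul' := fun _ _ => rfl }

/-- Split `X = (X - X̂) + X̂`: the first term is centred and independent of `X̂`, the second is a
function of `X̂`. -/
theorem condExp_clm_fst_eq {E F : Type*} [NormedAddCommGroup E] [NormedSpace ℝ E]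
    [MeasurableSpace E] [BorelSpace E] [CompleteSpace E] [SecondCountableTopology E]
    [NormedAddCommGroup F] [NormedSpace ℝ F] [CompleteSpace F] [MeasurableSpace F] [BorelSpace F]
    [SecondCountableTopology F] {π : Measure (E × E)} [IsGaussian π] (hπ : ∫ z, z ∂π = 0)
    (hind : IndepFun (fun z => z.1 - z.2) Prod.snd π) (L : E →L[ℝ] F) :
    π[fun z => L z.1 | MeasurableSpace.comap Prod.snd inferInstance] =ᵐ[π] fun z => L z.2 := by
  have hle : MeasurableSpace.comap (Prod.snd : E × E → E) inferInstance ≤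
      (inferInstance : MeasurableSpace (E × E)) := measurable_snd.comap_le
  have hint : ∀ M : E × E →L[ℝ] F, Integrable (fun z => M z) π := fun M =>
    M.integrable_comp IsGaussian.integrable_fun_id
  have i1 : Integrable (fun z : E × E => L (z.1 - z.2)) π :=
    hint (L.comp (ContinuousLinearMap.fst ℝ E E - ContinuousLinearMap.snd ℝ E E))
  have i2 : Integrable (fun z : E × E => L z.2) π :=
    hint (L.comp (ContinuousLinearMap.snd ℝ E E))
  have h0 : ∫ z : E × E, L (z.1 - z.2) ∂π = 0 :=
    integral_clm_eq_zero hπ (L.comp (ContinuousLinearMap.fst ℝ E E - ContinuousLinearMap.snd ℝ E E))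
  have hsub : Measurable fun z : E × E => z.1 - z.2 := by fun_prop
  have h1 : π[fun z : E × E => L (z.1 - z.2) | MeasurableSpace.comap Prod.snd inferInstance]
      =ᵐ[π] fun _ => 0 := by
    rw [← h0]
    refine condExp_indep_eq (m₁ := MeasurableSpace.comap (fun z : E × E => z.1 - z.2) inferInstance)
      hsub.comap_le hle ?_ hind
    exact (L.continuous.measurable.comp (comap_measurable _)).stronglyMeasurable
  have h2 : π[fun z : E × E => L z.2 | MeasurableSpace.comap Prod.snd inferInstance] =
      fun z => L z.2 := by
    refine condExp_of_stronglyMeasurable hle ?_ i2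
    exact (L.continuous.measurable.comp (comap_measurable _)).stronglyMeasurable
  have h3 : (fun z : E × E => L z.1) = (fun z => L (z.1 - z.2)) + fun z => L z.2 := by
    ext z; simp
  rw [h3]
  filter_upwards [condExp_add i1 i2 (MeasurableSpace.comap Prod.snd inferInstance), h1] with z h h'
  rw [h, Pi.add_apply, h', h2, zero_add]

/-- A zero mean jointly Gaussian pair with `X - X̂` uncorrelated with `X̂` satisfies
`E[X | X̂] = X̂`. -/
theorem condMeanEq_of_orthogonal {π : Measure (Vec p₁ p₂ × Vec p₁ p₂)} [IsGaussian π]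
    (hπ : ∫ z, z ∂π = 0) (h : ∀ i j, ∫ z, (z.1 i - z.2 i) * z.2 j ∂π = 0) : CondMeanEq π := by
  have hind : IndepFun (fun z => z.1 - z.2) Prod.snd π :=
    indepFun_of_orthogonal hπ (ContinuousLinearMap.fst ℝ _ _ - ContinuousLinearMap.snd ℝ _ _)
      (ContinuousLinearMap.snd ℝ _ _) h
  exact ⟨condExp_clm_fst_eq hπ hind block₁CLM, condExp_clm_fst_eq hπ hind block₂CLM⟩

/-- Multiplying by `cov(X̂, X̂)` gives `cov(X, X̂) = cov(X̂, X̂)`, so `X - X̂` is uncorrelated with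
`X̂`. -/
theorem condMeanEq_of_condition1 {π : Measure (Vec p₁ p₂ × Vec p₁ p₂)} [IsGaussian π]
    (hπ : ∫ z, z ∂π = 0) (h : Condition1 π) : CondMeanEq π := by
  have hC : crossCov π = reprCov π := by
    have := congrArg (· * reprCov π) h.2
    simpa [Matrix.mul_assoc, Matrix.nonsing_inv_mul _ h.1] using this
  refine condMeanEq_of_orthogonal hπ fun i j => ?_
  have h1 := memLp_fst_eval π i
  have h2 := memLp_snd_eval π
  have hm : ∫ z, z.2 j ∂π = 0 := integral_clm_eq_zero hπ
    ((EuclideanSpace.proj (𝕜 := ℝ) j).comp (ContinuousLinearMap.snd ℝ (Vec p₁ p₂) (Vec p₁ p₂)))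
  have := congrFun (congrFun hC i) j
  simp only [crossCov, reprCov, Matrix.of_apply] at this
  rw [covariance_eq_sub h1 (h2 j), covariance_eq_sub (h2 i) (h2 j), hm] at this
  simp only [mul_zero, sub_zero, Pi.mul_apply] at this
  simp_rw [sub_mul]
  have i1 : Integrable (fun z => z.1 i * z.2 j) π := h1.integrable_mul (h2 j)
  have i2 : Integrable (fun z => z.2 i * z.2 j) π := (h2 i).integrable_mul (h2 j)
  rw [integral_sub i1 i2]
  exact sub_eq_zero.2 this

end ConditionalMean

/-! ### Distortion constraints in coordinates. -/

section Distortion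

variable {p₁ p₂ : ℕ}

theorem enorm_block₁_sub_sq (x y : Vec p₁ p₂) :
    ‖block₁ x - block₁ y‖ₑ ^ 2 =
      ∑ i, ENNReal.ofReal ((x (Sum.inl i) - y (Sum.inl i)) ^ 2) := by
  rw [← ofReal_norm, ← ENNReal.ofReal_pow (norm_nonneg _), EuclideanSpace.real_norm_sq_eq,
    ENNReal.ofReal_sum_of_nonneg fun i _ => sq_nonneg _]
  rfl

theorem enorm_block₂_sub_sq (x y : Vec p₁ p₂) :
    ‖block₂ x - block₂ y‖ₑ ^ 2 =
      ∑ i, ENNReal.ofReal ((x (Sum.inr i) - y (Sum.inr i)) ^ 2) := by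
  rw [← ofReal_norm, ← ENNReal.ofReal_pow (norm_nonneg _), EuclideanSpace.real_norm_sq_eq,
    ENNReal.ofReal_sum_of_nonneg fun i _ => sq_nonneg _]
  rfl

/-- Finiteness of `Δ₁`, `Δ₂` puts the errors in `L²`, which opens every feasible law to Hilbert
space methods. -/
theorem MeetsDistortion.memLp {Δ₁ Δ₂ : ℝ≥0} {π : Measure (Vec p₁ p₂ × Vec p₁ p₂)}
    (h : MeetsDistortion Δ₁ Δ₂ π) (i : Fin p₁ ⊕ Fin p₂) :
    MemLp (fun z => z.1 i - z.2 i) 2 π := by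
  have hm : Measurable fun z : Vec p₁ p₂ × Vec p₁ p₂ => z.1 i - z.2 i := by fun_prop
  rw [memLp_two_iff_integrable_sq hm.aestronglyMeasurable]
  refine ⟨by fun_prop, ?_⟩
  rw [hasFiniteIntegral_iff_ofReal (ae_of_all _ fun z => sq_nonneg _)]
  obtain ⟨h1, h2⟩ := h
  simp_rw [enorm_block₁_sub_sq] at h1
  simp_rw [enorm_block₂_sub_sq] at h2
  cases i with
  | inl i =>
    refine (lintegral_mono fun z => ?_).trans_lt (h1.trans_lt ENNReal.coe_lt_top)
    exact Finset.single_le_sum (f := fun i =>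
      ENNReal.ofReal ((z.1 (Sum.inl i) - z.2 (Sum.inl i)) ^ 2)) (fun _ _ => zero_le)
      (Finset.mem_univ i)
  | inr i =>
    refine (lintegral_mono fun z => ?_).trans_lt (h2.trans_lt ENNReal.coe_lt_top)
    exact Finset.single_le_sum (f := fun i =>
      ENNReal.ofReal ((z.1 (Sum.inr i) - z.2 (Sum.inr i)) ^ 2)) (fun _ _ => zero_le)
      (Finset.mem_univ i)

theorem lintegral_sum_ofReal_sq {α ι : Type*} [MeasurableSpace α] [Fintype ι] {μ : Measure α}
    {f : ι → α → ℝ} (hm : ∀ i, Measurable (f i)) (hf : ∀ i, MemLp (f i) 2 μ) :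
    ∫⁻ a, ∑ i, ENNReal.ofReal (f i a ^ 2) ∂μ = ENNReal.ofReal (∑ i, ∫ a, f i a ^ 2 ∂μ) := by
  rw [lintegral_finsetSum _ fun i _ => by have := hm i; fun_prop,
    ENNReal.ofReal_sum_of_nonneg fun i _ => integral_nonneg fun a => sq_nonneg _]
  refine Finset.sum_congr rfl fun i _ => ?_
  rw [ofReal_integral_eq_lintegral_ofReal (hf i).integrable_sq (ae_of_all _ fun a => sq_nonneg _)]

theorem meetsDistortion_iff {Δ₁ Δ₂ : ℝ≥0} {π : Measure (Vec p₁ p₂ × Vec p₁ p₂)}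
    (h : ∀ i, MemLp (fun z => z.1 i - z.2 i) 2 π) :
    MeetsDistortion Δ₁ Δ₂ π ↔
      ∑ i, ∫ z, (z.1 (Sum.inl i) - z.2 (Sum.inl i)) ^ 2 ∂π ≤ Δ₁ ∧
        ∑ i, ∫ z, (z.1 (Sum.inr i) - z.2 (Sum.inr i)) ^ 2 ∂π ≤ Δ₂ := by
  unfold MeetsDistortion
  simp_rw [enorm_block₁_sub_sq, enorm_block₂_sub_sq]
  rw [lintegral_sum_ofReal_sq (fun i => by fun_prop) fun i => h (Sum.inl i),
    lintegral_sum_ofReal_sq (fun i => by fun_prop) fun i => h (Sum.inr i),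
    ENNReal.ofReal_le_iff_le_toReal ENNReal.coe_ne_top,
    ENNReal.ofReal_le_iff_le_toReal ENNReal.coe_ne_top]
  rfl

end Distortion

/-! ### Gaussian realizations and their laws. -/

section Realization

theorem integral_prod_eq_zero {E F : Type*} [NormedAddCommGroup E] [NormedSpace ℝ E]
    [MeasurableSpace E] [BorelSpace E] [CompleteSpace E] [SecondCountableTopology E]
    [NormedAddCommGroup F] [NormedSpace ℝ F] [MeasurableSpace F] [BorelSpace F] [CompleteSpace F]
    [SecondCountableTopology F] {μ : Measure E} {ν : Measure F} [IsGaussian μ] [IsGaussian ν]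
    (hμ : ∫ x, x ∂μ = 0) (hν : ∫ y, y ∂ν = 0) : ∫ p, p ∂(μ.prod ν) = 0 := by
  have hi : Integrable (fun p : E × F => p) (μ.prod ν) := IsGaussian.integrable_fun_id
  refine Prod.ext ?_ ?_
  · rw [fst_integral hi, Prod.fst_zero, ← hμ]
    have := (measurePreserving_fst (μ := μ) (ν := ν)).map_eq
    conv_rhs => rw [← this]
    rw [integral_map (by fun_prop) (by fun_prop)]
  · rw [snd_integral hi, Prod.snd_zero, ← hν]
    have := (measurePreserving_snd (μ := μ) (ν := ν)).map_eq
    conv_rhs => rw [← this]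
    rw [integral_map (by fun_prop) (by fun_prop)]

theorem integral_map_clm_eq_zero {E F : Type*} [NormedAddCommGroup E] [NormedSpace ℝ E]
    [MeasurableSpace E] [BorelSpace E] [CompleteSpace E] [SecondCountableTopology E]
    [NormedAddCommGroup F] [NormedSpace ℝ F] [MeasurableSpace F] [BorelSpace F] [CompleteSpace F]
    [SecondCountableTopology F] {μ : Measure E} [IsGaussian μ] (hμ : ∫ x, x ∂μ = 0)
    (L : E →L[ℝ] F) : ∫ y, y ∂(μ.map L) = 0 := by
  rw [integral_map (by fun_prop) (by fun_prop)]
  exact integral_clm_eq_zero hμ L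

variable {p₁ p₂ : ℕ} {Q H QV : Mat p₁ p₂} {π : Measure (Vec p₁ p₂ × Vec p₁ p₂)}

/-- The law is a linear image of a product of centred Gaussians, whence it is Gaussian with mean
zero. -/
theorem IsGaussianRealization.eq_map (h : IsGaussianRealization Q H QV π) :
    π = ((gaussianLaw Q).prod (gaussianLaw QV)).map
      ((ContinuousLinearMap.fst ℝ _ _).prod
        ((Matrix.toEuclideanLin H).toContinuousLinearMap.comp (ContinuousLinearMap.fst ℝ _ _) +
          ContinuousLinearMap.snd ℝ _ _)) := by
  obtain ⟨-, Ω, _, μ, _, X, V, Xhat, hX, hV, hind, hXhat, hlaw⟩ := h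
  have hXV := (indepFun_iff_map_prod_eq_prod_map_map hX.aemeasurable hV.aemeasurable).1 hind.symm
  rw [hX.map_eq, hV.map_eq] at hXV
  rw [← hXV, AEMeasurable.map_map_of_aemeasurable (by fun_prop)
    (hX.aemeasurable.prodMk hV.aemeasurable), ← hlaw.map_eq]
  congr 1
  ext ω : 1
  simp [hXhat]

theorem IsGaussianRealization.isGaussian (h : IsGaussianRealization Q H QV π) : IsGaussian π := by
  rw [h.eq_map]
  infer_instance

theorem IsGaussianRealization.integral_eq_zero (h : IsGaussianRealization Q H QV π) :
    ∫ z, z ∂π = 0 := by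
  rw [h.eq_map]
  exact integral_map_clm_eq_zero (integral_prod_eq_zero (by simp) (by simp)) _

theorem IsGaussianRealization.fst_eq (h : IsGaussianRealization Q H QV π) :
    π.fst = gaussianLaw Q := by
  obtain ⟨-, Ω, _, μ, _, X, V, Xhat, hX, -, -, -, hlaw⟩ := h
  rw [← hlaw.map_eq, Measure.fst, AEMeasurable.map_map_of_aemeasurable (by fun_prop)
    hlaw.aemeasurable, ← hX.map_eq]
  rfl

/-- A zero mean jointly Gaussian law is the law of a Gaussian realization, and its test channel
is `x ↦ G(H x, QV)`. -/
theorem exists_isGaussianRealization [IsGaussian π] (hfst : π.fst = gaussianLaw Q)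
    (hπ : ∫ z, z ∂π = 0) :
    ∃ H QV : Mat p₁ p₂, IsGaussianRealization Q H QV π ∧
      ∀ᵐ x ∂(gaussianLaw Q),
        π.condKernel x = multivariateGaussian (Matrix.toEuclideanLin H x) QV := by
  obtain ⟨H, QV, hQV, hind, hlaw⟩ := exists_gaussian_regression hπ
  -- The probability space is the product space under `π` itself, with `V` the regression residual.
  refine ⟨H, QV, ⟨hQV, Vec p₁ p₂ × Vec p₁ p₂, inferInstance, π, inferInstance, Prod.fst,
    fun z => z.2 - Matrix.toEuclideanLin H z.1, Prod.snd, ⟨by fun_prop, hfst⟩, hlaw, hind,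
    fun z => by simp, ⟨by fun_prop, Measure.map_id⟩⟩, ?_⟩
  rw [← hfst]
  exact condKernel_ae_eq_multivariateGaussian hind hlaw

theorem feasibleCMG_subset_feasibleCM (Q : Mat p₁ p₂) (Δ₁ Δ₂ : ℝ≥0) :
    feasibleCMG Q Δ₁ Δ₂ ⊆ feasibleCM Q Δ₁ Δ₂ := by
  rintro π ⟨⟨H, QV, h⟩, hcm, hdist⟩
  have := h.isGaussian
  exact ⟨⟨inferInstance, h.fst_eq, hdist⟩, hcm⟩

end Realization

/-! ### The finite-dimensional parameter set. -/

section Parameters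

variable {p₁ p₂ : ℕ} {J : Type*} [Fintype J]

/-- The pairs `(A, s)` with `A Aᵀ = Q` and `sⱼ ∈ [0, 1]` for which the error covariance
`A diag(s) Aᵀ` meets the distortion constraints. -/
def parameterSet (J : Type*) [Fintype J] (Q : Mat p₁ p₂) (Δ₁ Δ₂ : ℝ≥0) :
    Set (Matrix (Fin p₁ ⊕ Fin p₂) J ℝ × (J → ℝ)) :=
  {P | P.1 * P.1ᵀ = Q ∧ (∀ j, P.2 j ∈ Set.Icc (0 : ℝ) 1) ∧
    ∑ i, ∑ j, P.1 (Sum.inl i) j ^ 2 * P.2 j ≤ Δ₁ ∧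
    ∑ i, ∑ j, P.1 (Sum.inr i) j ^ 2 * P.2 j ≤ Δ₂}

theorem isCompact_parameterSet (Q : Mat p₁ p₂) (Δ₁ Δ₂ : ℝ≥0) :
    IsCompact (parameterSet J Q Δ₁ Δ₂) := by
  -- The diagonal of `A Aᵀ = Q` gives `Aᵢⱼ² ≤ Qᵢᵢ`, hence `|Aᵢⱼ| ≤ Qᵢᵢ + 1`, a bound free of square
  -- roots.
  have hbox : IsCompact ((Set.univ.pi fun i => Set.univ.pi fun _ : J =>
      Set.Icc (-(Q i i + 1)) (Q i i + 1)) ×ˢ Set.univ.pi fun _ : J => Set.Icc (0 : ℝ) 1) :=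
    (isCompact_univ_pi fun i => isCompact_univ_pi fun _ => isCompact_Icc).prod
      (isCompact_univ_pi fun _ => isCompact_Icc)
  refine hbox.of_isClosed_subset ?_ ?_
  · have hent : ∀ i j, Continuous fun P : Matrix (Fin p₁ ⊕ Fin p₂) J ℝ × (J → ℝ) => P.1 i j :=
      fun i j => (continuous_apply_apply i j).comp continuous_fst
    have hs : ∀ j, Continuous fun P : Matrix (Fin p₁ ⊕ Fin p₂) J ℝ × (J → ℝ) => P.2 j :=
      fun j => (continuous_apply j).comp continuous_snd
    refine IsClosed.inter ?_ (IsClosed.inter ?_ (IsClosed.inter ?_ ?_))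
    · exact isClosed_eq (continuous_fst.matrix_mul continuous_fst.matrix_transpose)
        continuous_const
    · change IsClosed {P : Matrix (Fin p₁ ⊕ Fin p₂) J ℝ × (J → ℝ) |
        ∀ j, P.2 j ∈ Set.Icc (0 : ℝ) 1}
      rw [Set.ofPred_forall]
      exact isClosed_iInter fun j => isClosed_Icc.preimage (hs j)
    · exact isClosed_le (continuous_finsetSum _ fun i _ => continuous_finsetSum _ fun j _ =>
        ((hent _ j).pow 2).mul (hs j)) continuous_const
    · exact isClosed_le (continuous_finsetSum _ fun i _ => continuous_finsetSum _ fun j _ =>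
        ((hent _ j).pow 2).mul (hs j)) continuous_const
  · rintro ⟨A, s⟩ ⟨hA, hs, -⟩
    refine ⟨fun i _ j _ => ?_, fun j _ => hs j⟩
    have hQ : Q i i = ∑ k, A i k ^ 2 := by
      rw [← hA, Matrix.mul_apply]
      simp only [sq]
      rfl
    have : A i j ^ 2 ≤ Q i i := by
      rw [hQ]
      exact Finset.single_le_sum (f := fun k => A i k ^ 2) (fun _ _ => sq_nonneg _)
        (Finset.mem_univ j)
    constructor <;> nlinarith [sq_nonneg (A i j - 1), sq_nonneg (A i j + 1)]

end Parameters

/-! ### Linear images of possibly singular Gaussians. -/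

section LinearImages

variable {n J : Type*} [Fintype n] [DecidableEq n] [Fintype J] [DecidableEq J]

theorem map_multivariateGaussian {S : Matrix J J ℝ} (hS : S.PosSemidef) (A : Matrix n J ℝ) :
    (multivariateGaussian 0 S).map (Matrix.toEuclideanLin A).toContinuousLinearMap =
      multivariateGaussian 0 (A * S * Aᵀ) := by
  have hAS : (A * S * Aᵀ).PosSemidef := by
    simpa using hS.mul_mul_conjTranspose_same A
  refine IsGaussian.ext ?_ ?_
  · simpa using integral_map_clm_eq_zero
      (integral_id_multivariateGaussian (μ := 0) (S := S))
      (Matrix.toEuclideanLin A).toContinuousLinearMap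
  · ext x y
    have hadj : ∀ x, ContinuousLinearMap.adjoint
        (Matrix.toEuclideanLin A).toContinuousLinearMap x = Matrix.toEuclideanLin Aᵀ x :=
      fun x => by
        refine ext_inner_right ℝ fun y => ?_
        rw [ContinuousLinearMap.adjoint_inner_left]
        simp [Matrix.toLpLin_apply, EuclideanSpace.inner_eq_star_dotProduct,
          Matrix.mulVec_transpose, Matrix.dotProduct_mulVec, dotProduct_comm]
    rw [covarianceBilin_map IsGaussian.memLp_two_id, covarianceBilin_multivariateGaussian hS,
      covarianceBilin_multivariateGaussian hAS, hadj, hadj]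
    simp only [Matrix.toLpLin_apply, ← Matrix.mulVec_mulVec]
    rw [Matrix.dotProduct_mulVec x.ofLp A, Matrix.mulVec_transpose A x.ofLp]

end LinearImages

/-! ### From a parameter to a Gaussian realization. -/

section Achievability

variable {p₁ p₂ : ℕ} {J : Type*} [Fintype J] [DecidableEq J]

/-- Every parameter yields a feasible Gaussian realization with the conditional mean property
whose mutual information is at most `-½ log ∏ sⱼ`. -/
theorem exists_mem_feasibleCMG {Q : Mat p₁ p₂} {Δ₁ Δ₂ : ℝ≥0}
    {A : Matrix (Fin p₁ ⊕ Fin p₂) J ℝ} {s : J → ℝ} (h : (A, s) ∈ parameterSet J Q Δ₁ Δ₂) :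
    ∃ π ∈ feasibleCMG Q Δ₁ Δ₂,
      (0 < ∏ j, s j → mutualInfo π ≤ ENNReal.ofReal (-Real.log (∏ j, s j) / 2)) := by
  obtain ⟨hAQ, hs, hd1, hd2⟩ := h
  have hpsd : (Matrix.diagonal s).PosSemidef := Matrix.PosSemidef.diagonal fun j => (hs j).1
  let a : EuclideanSpace ℝ J →L[ℝ] Vec p₁ p₂ := (Matrix.toEuclideanLin A).toContinuousLinearMap
  let Y := multivariateGaussian (0 : EuclideanSpace ℝ J) (Matrix.diagonal fun j => 1 - s j)
  let Z := multivariateGaussian (0 : EuclideanSpace ℝ J) (Matrix.diagonal s)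
  let L : EuclideanSpace ℝ J × EuclideanSpace ℝ J →L[ℝ] Vec p₁ p₂ × Vec p₁ p₂ :=
    (a.comp (ContinuousLinearMap.fst ℝ _ _ + ContinuousLinearMap.snd ℝ _ _)).prod
      (a.comp (ContinuousLinearMap.fst ℝ _ _))
  -- The law of `(A (Y + Z), A Y)`; mapping the two components separately makes data processing
  -- applicable.
  let π := (diagonalTestLaw s).map (Prod.map a a)
  have hπL : π = (Y.prod Z).map L := by
    simp only [π, diagonalTestLaw]
    rw [Measure.map_map (by fun_prop) (by fun_prop)]
    rfl
  have hGauss : IsGaussian π := by rw [hπL]; infer_instance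
  have hzero : ∫ z, z ∂π = 0 := by
    rw [hπL]
    exact integral_map_clm_eq_zero (integral_prod_eq_zero (by simp [Y]) (by simp [Z])) L
  have hfst : π.fst = gaussianLaw Q := by
    have : π.fst = (diagonalTestLaw s).fst.map a := by
      rw [Measure.fst, Measure.fst, Measure.map_map (by fun_prop) (by fun_prop),
        Measure.map_map (by fun_prop) (by fun_prop)]
      rfl
    rw [this, fst_diagonalTestLaw hs, ← multivariateGaussian_zero_one,
      map_multivariateGaussian Matrix.PosSemidef.one, Matrix.mul_one, hAQ]
  have herr : π.map (fun z => z.1 - z.2) = multivariateGaussian 0 (A * Matrix.diagonal s * Aᵀ) := by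
    rw [← map_multivariateGaussian hpsd, hπL, Measure.map_map (by fun_prop) (by fun_prop)]
    have : (fun z : Vec p₁ p₂ × Vec p₁ p₂ => z.1 - z.2) ∘ L = a ∘ Prod.snd := by
      ext q : 1
      simp [L]
    rw [this, ← Measure.map_map (by fun_prop) (by fun_prop)]
    congr 1
    exact measurePreserving_snd.map_eq
  have hL2 : ∀ i, MemLp (fun z => z.1 i - z.2 i) 2 π := fun i =>
    (memLp_fst_eval π i).sub (memLp_snd_eval π i)
  have hsq : ∀ i, ∫ z, (z.1 i - z.2 i) ^ 2 ∂π = ∑ j, A i j ^ 2 * s j := fun i => by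
    have h := integral_mul_multivariateGaussian
      (S := A * Matrix.diagonal s * Aᵀ) (by simpa using hpsd.mul_mul_conjTranspose_same A) i i
    rw [← herr, integral_map (by fun_prop) (by fun_prop), Matrix.mul_apply] at h
    simp only [Matrix.mul_diagonal, Matrix.transpose_apply, PiLp.sub_apply] at h
    simp_rw [sq, h]
    exact Finset.sum_congr rfl fun j _ => by ring
  have hcm : CondMeanEq π := by
    refine condMeanEq_of_orthogonal hzero fun i j => ?_
    have h0 : ∫ y, a y j ∂Y = 0 :=
      integral_clm_eq_zero (by simp [Y]) ((EuclideanSpace.proj (𝕜 := ℝ) j).comp a)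
    rw [hπL, integral_map (by fun_prop) (by fun_prop)]
    have : ∀ q : EuclideanSpace ℝ J × EuclideanSpace ℝ J,
        ((L q).1 i - (L q).2 i) * (L q).2 j = a q.1 j * a q.2 i := fun q => by
      simp [L]; ring
    simp_rw [this]
    rw [integral_prod_mul (fun y => a y j) (fun z => a z i), h0, zero_mul]
  obtain ⟨H, QV, hreal, -⟩ := exists_isGaussianRealization hfst hzero
  refine ⟨π, ⟨⟨H, QV, hreal⟩, hcm, ?_⟩, fun hpos => ?_⟩
  · rw [meetsDistortion_iff hL2]
    simp_rw [hsq]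
    exact ⟨hd1, hd2⟩
  · have hne : ∀ j, s j ≠ 0 := fun j => Finset.prod_ne_zero_iff.1 hpos.ne' j (Finset.mem_univ j)
    rw [← mutualInfo_diagonalTestLaw fun j => ⟨(hs j).1.lt_of_ne' (hne j), (hs j).2⟩]
    exact mutualInfo_map_le _ (by fun_prop) (by fun_prop)

end Achievability

/-! ### From a feasible law to a parameter, and existence of a minimiser. -/

section Converse

variable {p₁ p₂ : ℕ} {J : Type*} [Fintype J] [DecidableEq J]

/-- Every feasible law yields a parameter whose value bounds its mutual information from below. -/
theorem exists_parameter_of_feasible {Q : Mat p₁ p₂} {Δ₁ Δ₂ : ℝ≥0}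
    {B : Matrix (Fin p₁ ⊕ Fin p₂) J ℝ} {D : Matrix J (Fin p₁ ⊕ Fin p₂) ℝ} (hB : B * Bᵀ = Q)
    (hDB : D * B = 1) {π : Measure (Vec p₁ p₂ × Vec p₁ p₂)} (hπ : π ∈ feasible Q Δ₁ Δ₂) :
    ∃ A s, (A, s) ∈ parameterSet J Q Δ₁ Δ₂ ∧
      (0 < ∏ j, s j → ENNReal.ofReal (-Real.log (∏ j, s j) / 2) ≤ mutualInfo π) ∧
      (∏ j, s j = 0 → mutualInfo π = ∞) := by
  obtain ⟨hprob, hfst, hdist⟩ := hπ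
  have hQ : Q.PosSemidef := by
    rw [← hB]
    simpa using Matrix.posSemidef_self_mul_conjTranspose B
  have hQD : ∀ O : Matrix J J ℝ, O * O.transpose = 1 → (O * D) * Q * (O * D)ᵀ = 1 := fun O hO => by
    rw [← hB, Matrix.transpose_mul]
    calc O * D * (B * Bᵀ) * (Dᵀ * Oᵀ) = O * (D * B) * (D * B)ᵀ * Oᵀ := by
          rw [Matrix.transpose_mul]; simp only [Matrix.mul_assoc]
      _ = 1 := by rw [hDB]; simpa using hO
  have hstd : ∀ O : Matrix J J ℝ, O * O.transpose = 1 →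
      π.fst.map (Matrix.toEuclideanLin (O * D)).toContinuousLinearMap =
        stdGaussian (EuclideanSpace ℝ J) := fun O hO => by
    rw [hfst, map_multivariateGaussian hQ, hQD O hO, multivariateGaussian_zero_one]
  have hpres : MeasurePreserving Prod.fst π (gaussianLaw Q) := ⟨measurable_fst, hfst⟩
  have hX : ∀ i, MemLp (fun z => z.1 i) 2 π := fun i =>
    (memLp_eval_of_isGaussian (gaussianLaw Q) i).comp_measurePreserving hpres
  have hE := hdist.memLp
  have hY : ∀ i, MemLp (fun z => z.2 i) 2 π := fun i => by
    have := (hX i).sub (hE i)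
    convert this using 2
    simp
  have hD : ∀ x : Vec p₁ p₂, ∀ j, Matrix.toEuclideanLin D x j = ∑ i, D j i * x i := fun x j => by
    simp [Matrix.toLpLin_apply, Matrix.mulVec, dotProduct]
  have hW : ∀ j, MemLp (fun z => ∑ i, D j i * z.1 i) 2 π := fun j => memLp_linearCombination hX _
  have hstdD : π.map (fun z => Matrix.toEuclideanLin D z.1) = stdGaussian (EuclideanSpace ℝ J) := by
    have := hstd 1 (by simp)
    rw [Matrix.one_mul, Measure.fst, Measure.map_map (by fun_prop) (by fun_prop)] at this
    exact this
  have hDm : Measurable (Matrix.toEuclideanLin D) :=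
    (Matrix.toEuclideanLin D).toContinuousLinearMap.continuous.measurable
  have horth : Orthonormal ℝ fun j => (hW j).toLp (fun z : Vec p₁ p₂ × Vec p₁ p₂ => ∑ i, D j i * z.1 i) := by
    rw [orthonormal_iff_ite]
    intro j k
    rw [inner_toLp_toLp, ← integral_mul_stdGaussian j k, ← hstdD,
      integral_map (by fun_prop) (by fun_prop)]
    simp_rw [hD]
  have hXW : ∀ i, (hX i).toLp (fun z => z.1 i) =
      ∑ j, B i j • (hW j).toLp (fun z : Vec p₁ p₂ × Vec p₁ p₂ => ∑ i, D j i * z.1 i) := fun i => by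
    rw [← toLp_linearCombination hW]
    refine MemLp.toLp_congr _ _ ?_
    -- `G(0, Q)` is carried by the range of `B`, on which `B D` is the identity.
    have hae : ∀ᵐ x ∂(gaussianLaw Q), x i = ∑ j, B i j * Matrix.toEuclideanLin D x j := by
      have hQB : gaussianLaw Q = (stdGaussian (EuclideanSpace ℝ J)).map
          (Matrix.toEuclideanLin B).toContinuousLinearMap := by
        rw [← multivariateGaussian_zero_one, map_multivariateGaussian Matrix.PosSemidef.one,
          Matrix.mul_one, hB]
      rw [hQB, ae_map_iff (by fun_prop) (measurableSet_eq_fun (by fun_prop) (by fun_prop))]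
      refine ae_of_all _ fun w => ?_
      have : D *ᵥ B *ᵥ w.ofLp = w.ofLp := by rw [Matrix.mulVec_mulVec, hDB, Matrix.one_mulVec]
      simp [Matrix.toLpLin_apply, this]
      rfl
    filter_upwards [hpres.quasiMeasurePreserving.ae hae] with z hz
    rw [hz]
    simp_rw [hD]
  obtain ⟨O, C, e, h1, h2, he, hle, hbound⟩ :=
    exists_rotated_residuals horth
      (fun i => (hY i).toLp (fun z : Vec p₁ p₂ × Vec p₁ p₂ => z.2 i)) B
  simp_rw [← hXW, ← MemLp.toLp_sub, norm_toLp_sq] at hbound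
  have hres : ∀ (z : Vec p₁ p₂ × Vec p₁ p₂) j,
      Matrix.toEuclideanLin (Oᵀ * D) z.1 j - Matrix.toEuclideanLin C z.2 j =
        ∑ k, O k j * ∑ i, D k i * z.1 i - ∑ i, C j i * z.2 i := fun z j => by
    simp only [Matrix.toLpLin_apply, ← Matrix.mulVec_mulVec]
    simp [Matrix.mulVec, dotProduct]
  have hrL2 : ∀ j, MemLp (fun z : Vec p₁ p₂ × Vec p₁ p₂ =>
      Matrix.toEuclideanLin (Oᵀ * D) z.1 j - Matrix.toEuclideanLin C z.2 j) 2 π := fun j => by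
    simp_rw [hres]
    exact (memLp_linearCombination hW _).sub (memLp_linearCombination hY _)
  have hrint : ∀ j, ∫ z, (Matrix.toEuclideanLin (Oᵀ * D) z.1 j -
      Matrix.toEuclideanLin C z.2 j) ^ 2 ∂π = ‖e j‖ ^ 2 := fun j => by
    rw [he j, ← toLp_linearCombination hW, ← toLp_linearCombination hY, ← MemLp.toLp_sub,
      norm_toLp_sq]
    simp_rw [hres]
    rfl
  have hs : ∀ j, ‖e j‖ ^ 2 ∈ Set.Icc (0 : ℝ) 1 := fun j =>
    ⟨by positivity, pow_le_one₀ (norm_nonneg _) (hle j)⟩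
  obtain ⟨hd1, hd2⟩ := (meetsDistortion_iff hE).1 hdist
  refine ⟨B * O, fun j => ‖e j‖ ^ 2, ⟨?_, hs, ?_, ?_⟩, ?_⟩
  · rw [Matrix.transpose_mul, Matrix.mul_assoc, ← Matrix.mul_assoc O, h2, Matrix.one_mul, hB]
  · exact (Finset.sum_le_sum fun i _ => hbound (Sum.inl i)).trans hd1
  · exact (Finset.sum_le_sum fun i _ => hbound (Sum.inr i)).trans hd2
  · exact mutualInfo_ge_of_errors
      (W := (Matrix.toEuclideanLin (Oᵀ * D)).toContinuousLinearMap)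
      (M := (Matrix.toEuclideanLin C).toContinuousLinearMap) (by fun_prop)
      (hstd Oᵀ (by simpa using h1)) (by fun_prop) hrL2 hs hrint

/-- Some Gaussian realization with the conditional mean property minimises the mutual information
over all feasible laws. -/
theorem exists_minimizer {Q : Mat p₁ p₂} (hQ : Q.PosSemidef) (Δ₁ Δ₂ : ℝ≥0) :
    ∃ π ∈ feasibleCMG Q Δ₁ Δ₂, ∀ π' ∈ feasible Q Δ₁ Δ₂, mutualInfo π ≤ mutualInfo π' := by
  obtain ⟨J, B, D, hB, hDB⟩ := exists_fullRank_factorization hQ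
  -- The pair `(B, 0)` has zero error, so it is admissible even for `Δ₁ = Δ₂ = 0`.
  have hne : (parameterSet J Q Δ₁ Δ₂).Nonempty := ⟨(B, 0), hB, by simp, by simp, by simp⟩
  obtain ⟨⟨A, s⟩, hAs, hmax⟩ := (isCompact_parameterSet Q Δ₁ Δ₂).exists_isMaxOn hne
    (f := fun P : Matrix (Fin p₁ ⊕ Fin p₂) J ℝ × (J → ℝ) => ∏ j, P.2 j)
    (continuous_finsetProd _ fun j _ => (continuous_apply j).comp continuous_snd).continuousOn
  obtain ⟨π, hπ, hI⟩ := exists_mem_feasibleCMG hAs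
  refine ⟨π, hπ, fun π' hπ' => ?_⟩
  obtain ⟨A', s', hAs', hpos, hzero⟩ := exists_parameter_of_feasible hB hDB hπ'
  have hle : ∏ j, s' j ≤ ∏ j, s j := hmax hAs'
  -- If the competitor's product vanishes its information is infinite; otherwise the maximal product
  -- is positive too and monotonicity of `log` compares the values.
  rcases (Finset.prod_nonneg fun j _ => (hAs'.2.1 j).1 : 0 ≤ ∏ j, s' j).eq_or_lt' with h | h
  · rw [hzero h]
    exact le_top
  · refine (hI (h.trans_le hle)).trans (le_trans (ENNReal.ofReal_le_ofReal ?_) (hpos h))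
    have := Real.log_le_log h hle
    linarith

end Converse

end JointRDF

/-! ### Assembly of the three claims from one minimiser. -/

open JointRDF in
theorem mainTheorem7 (p₁ p₂ : ℕ) (hp₁ : 0 < p₁) (hp₂ : 0 < p₂)
    (Q : Mat p₁ p₂) (hQ : Q.PosSemidef) (Δ₁ Δ₂ : ℝ≥0) :
    -- (a) a (zero mean) jointly Gaussian law attains the joint RDF
    (∃ π ∈ feasible Q Δ₁ Δ₂, IsGaussian π ∧ ∫ z, z ∂π = 0 ∧ mutualInfo π = rdf Q Δ₁ Δ₂) ∧
    -- (b) an optimal law is induced by a realization `X̂ = H X + V`, and every zero mean jointly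
    -- Gaussian feasible law is so induced, its test channel being `x ↦ G(H x, QV)`
    ((∃ H QV : Mat p₁ p₂, ∃ π ∈ feasible Q Δ₁ Δ₂,
        IsGaussianRealization Q H QV π ∧ mutualInfo π = rdf Q Δ₁ Δ₂) ∧
      (∀ π ∈ feasible Q Δ₁ Δ₂, ∀ [IsGaussian π], ∫ z, z ∂π = 0 →
        ∃ H QV : Mat p₁ p₂, IsGaussianRealization Q H QV π ∧
          ∀ᵐ x ∂(gaussianLaw Q),
            π.condKernel x = multivariateGaussian (Matrix.toEuclideanLin H x) QV)) ∧
    -- (c) the infimum may be taken over Gaussian realizations with `X̂ᵢ = E[Xᵢ | X̂]`;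
    -- Condition 1 is a special case of the conditional mean condition
    (feasibleCMG Q Δ₁ Δ₂ ⊆ feasibleCM Q Δ₁ Δ₂ ∧
      (feasibleCMG Q Δ₁ Δ₂).Nonempty ∧
      rdf Q Δ₁ Δ₂ = (⨅ π ∈ feasibleCMG Q Δ₁ Δ₂, mutualInfo π) ∧
      (∀ (H QV : Mat p₁ p₂) (π : Measure (Vec p₁ p₂ × Vec p₁ p₂)),
        IsGaussianRealization Q H QV π → Condition1 π → CondMeanEq π)) := by
  obtain ⟨π, hπ, hmin⟩ := exists_minimizer hQ Δ₁ Δ₂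
  have hsub := feasibleCMG_subset_feasibleCM Q Δ₁ Δ₂
  have hfeas : π ∈ feasible Q Δ₁ Δ₂ := (hsub hπ).1
  have hrdf : mutualInfo π = rdf Q Δ₁ Δ₂ :=
    le_antisymm (le_iInf₂ hmin) (iInf₂_le π hfeas)
  obtain ⟨H, QV, hreal⟩ := hπ.1
  refine ⟨⟨π, hfeas, hreal.isGaussian, hreal.integral_eq_zero, hrdf⟩,
    ⟨⟨H, QV, π, hfeas, hreal, hrdf⟩, fun π' hπ' _ hzero =>
      exists_isGaussianRealization hπ'.2.1 hzero⟩,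
    hsub, ⟨π, hπ⟩, le_antisymm ?_ ?_, fun H QV π' h hC => ?_⟩
  · exact le_iInf₂ fun π' hπ' => iInf₂_le π' (hsub hπ').1
  · rw [← hrdf]
    exact iInf₂_le π hπ
  · have := h.isGaussian
    exact condMeanEq_of_condition1 h.integral_eq_zero hC
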